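/- Let $(Q,N,C_1,C_2,\dots)$ be a random vector with $Q$ and all $C_i$ real valued and $N\in\{0,1,2,\dots\}$, and for $\gamma>0$ put $\rho_\gamma=E\big[\sum_{i=1}^N|C_i|^\gamma\big]$. *The process $R^{(k)}$.* Let $U=\bigcup_{n\ge0}\{1,2,\dots\}^n$ be the set of finite sequences of positive integers, with the empty sequence $\emptyset$, and let $\{(Q_{\mathbf i},N_{\mathbf i},C_{(\mathbf i,1)},C_{(\mathbf i,2)},\dots)\}_{\mathbf i\in U}$ be i.i.d. copies of $(Q,N,C_1,C_2,\dots)$. Put $A_0=\{\emptyset\}$, $A_n=\{(\mathbf i,r):\mathbf i\in A_{n-1},\,1\le r\le N_{\mathbf i}\}$ for $n\ge1$, $\Pi_\emptyset=1$, $\Pi_{(\mathbf i,r)}=C_{(\mathbf i,r)}\Pi_{\mathbf i}$, and $$R^{(k)}=\sum_{j=0}^k\sum_{\mathbf i\in A_j}Q_{\mathbf i}\Pi_{\mathbf i},\qquad k\ge0.$$ Let $F_k$ be the law of $R^{(k)}$. *The iterative bootstrap algorithm.* Fix a pool size $m\ge1$. Let $\hat R^{(0,m)}_1,\dots,\hat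 R^{(0,m)}_m$ be i.i.d. copies of $Q$. For $j\ge1$, given the pool $(\hat R^{(j-1,m)}_1,\dots,\hat R^{(j-1,m)}_m)$, take i.i.d. copies $(Q_i,N_i,C_{(i,1)},C_{(i,2)},\dots)$, $1\le i\le m$, of $(Q,N,C_1,C_2,\dots)$, independent of everything else, and put $$\hat R^{(j,m)}_i=\sum_{r=1}^{N_i}C_{(i,r)}\hat R^{(j-1,m)}_{(i,r)}+Q_i,\qquad 1\le i\le m,$$ where the $\hat R^{(j-1,m)}_{(i,r)}$ are drawn independently and uniformly with replacement from the pool at level $j-1$ (that is, they are its members at independent uniform positions, independent of everything else). Let $\hat F_{k,m}=\frac1m\sum_{i=1}^m\delta_{\hat R^{(k,m)}_i}$ be the empirical distribution of the pool at level $k$. *Distance.* For probability measures $\mu,\nu$ on $\mathbb R$ let $d_1(\mu,\nu)=\inf_\pi\int_{\mathbb R\times\mathbb R}|x-y|\,d\pi(x,y)$, the infimum over all probability measures $\pi$ on $\mathbb R\times\mathbb R$ with marginals $\mu$ and $\nu$ (the Kantorovich–Rubinstein or Wasserstein-1 distance). **Theorem.** Let $\beta>1$ be such that $E[|Q|^\beta]<\infty$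 and $E\big[\big(\sum_{i=1}^N|C_i|\big)^\beta\big]<\infty$, and assume that either (i) $\max(\rho_1,\rho_\beta)<1$, or (ii) $\beta=2$, $\rho_1=1$, $\rho_\beta<1$ and $E[Q]=0$. Then for every $\alpha\in(1,2)$ with $\alpha\le\beta$ there is a constant $K_\alpha<\infty$, depending on $\alpha$ and the law of $(Q,N,C_1,C_2,\dots)$ but not on $k$ or $m$, such that for all $k\ge0$ and $m\ge1$ $$E\big[d_1(\hat F_{k,m},F_k)\big]\le K_\alpha\,m^{-1+1/\alpha}\sum_{i=0}^k\rho_1^i.$$ -/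

import Mathlib

open MeasureTheory ProbabilityTheory
open scoped ENNReal

noncomputable section

namespace IterBootstrap

/-- The value space of a branching vector `(Q, N, C₁, C₂, …)`, with the weights `C_{r+1}`
stored at position `r`, so that `∑_{r=1}^N` becomes a sum over `Finset.range N`. -/
abbrev BranchVec : Type := ℝ × ℕ × (ℕ → ℝ)

/-- The `Q` component. -/
def BranchVec.Q (v : BranchVec) : ℝ := v.1

/-- The `N` component. -/
def BranchVec.N (v : BranchVec) : ℕ := v.2.1

/-- The weights. -/
def BranchVec.C (v : BranchVec) (r : ℕ) : ℝ := v.2.2 r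

/-- `ρ_β = E[∑_{i=1}^N |C_i|^β]`, where `μ` is the law of the generic branching vector. -/
def rho (μ : Measure BranchVec) (β : ℝ) : ℝ :=
  ∫ v, ∑ i ∈ Finset.range (BranchVec.N v), |BranchVec.C v i| ^ β ∂μ

/-- The moment conditions on the generic branching vector with law `μ`. -/
structure MomentConditions (μ : Measure BranchVec) (β : ℝ) : Prop where
  one_le : 1 ≤ β
  moment_Q : Integrable (fun v => |BranchVec.Q v| ^ β) μ
  moment_C : Integrable
    (fun v => (∑ i ∈ Finset.range (BranchVec.N v), |BranchVec.C v i|) ^ β) μ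
  contraction : max (rho μ 1) (rho μ β) < 1 ∨
    (β = 2 ∧ rho μ 1 = 1 ∧ rho μ β < 1 ∧ ∫ v, BranchVec.Q v ∂μ = 0)

section WeightedBranching

variable {Ω : Type*}

/-- `V` is an i.i.d. family of copies of the generic branching vector, indexed by the nodes of
the infinite tree `U`. A node `(i₁, …, iₙ)` is the list `[iₙ, …, i₁]`, so that the child
`(𝐢, r)` of the node `𝐢` is `r :: 𝐢`; children are numbered from `0`. -/
structure IsBranchingFamily [MeasurableSpace Ω] (μ : Measure BranchVec) (P : Measure Ω)
    (V : List ℕ → Ω → BranchVec) : Prop where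
  measurable : ∀ i, Measurable (V i)
  law : ∀ i, P.map (V i) = μ
  indep : iIndepFun V P

/-- The `n`th generation `A_n` of the tree. -/
def generation (V : List ℕ → Ω → BranchVec) (ω : Ω) : ℕ → Finset (List ℕ)
  | 0 => {[]}
  | n + 1 => (generation V ω n).biUnion fun i =>
      (Finset.range (BranchVec.N (V i ω))).image fun r => r :: i

/-- The weight `Π_𝐢` of a node: `Π_∅ = 1`, `Π_{(𝐢, r)} = C_{(𝐢, r)} Π_𝐢`. -/
def weight (V : List ℕ → Ω → BranchVec) (ω : Ω) : List ℕ → ℝ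
  | [] => 1
  | r :: i => BranchVec.C (V i ω) r * weight V ω i

/-- `R^{(k)} = ∑_{j=0}^k ∑_{𝐢 ∈ A_j} Q_𝐢 Π_𝐢`. -/
def R (V : List ℕ → Ω → BranchVec) (k : ℕ) (ω : Ω) : ℝ :=
  ∑ j ∈ Finset.range (k + 1), ∑ i ∈ generation V ω j, BranchVec.Q (V i ω) * weight V ω i

end WeightedBranching

section Algorithm

variable {Ω : Type*} {m : ℕ}

/-- The randomness consumed by the algorithm with pool size `m`:
* `Q₀ i`, for the initial pool, are copies of `Q`;
* `V j i` is the branching vector used for member `i` of the pool at level `j + 1`;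
* `I j i r` is the position, uniform among `0, …, m - 1`, of the member of the level-`j` pool
  that is drawn as the `r`th summand of member `i` of the pool at level `j + 1`.

All of these random elements are jointly independent. -/
structure IsAlgorithmInput [MeasurableSpace Ω] (μ : Measure BranchVec) (P : Measure Ω)
    (Q₀ : Fin m → Ω → ℝ) (V : ℕ → Fin m → Ω → BranchVec)
    (I : ℕ → Fin m → ℕ → Ω → Fin m) : Prop where
  measurable_Q₀ : ∀ i, Measurable (Q₀ i)
  measurable_V : ∀ j i, Measurable (V j i)
  measurable_I : ∀ j i r, Measurable (I j i r)
  law_Q₀ : ∀ i, P.map (Q₀ i) = μ.map BranchVec.Q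
  law_V : ∀ j i, P.map (V j i) = μ
  law_I : ∀ j i r, P.map (I j i r) = uniformOn Set.univ
  indep_Q₀ : iIndepFun Q₀ P
  indep_V : iIndepFun (fun p : ℕ × Fin m => V p.1 p.2) P
  indep_I : iIndepFun (fun p : ℕ × Fin m × ℕ => I p.1 p.2.1 p.2.2) P
  indep_V_I : IndepFun (fun ω (p : ℕ × Fin m) => V p.1 p.2 ω)
    (fun ω (p : ℕ × Fin m × ℕ) => I p.1 p.2.1 p.2.2 ω) P
  indep_Q₀_V_I : IndepFun (fun ω i => Q₀ i ω)
    (fun ω => ((fun p : ℕ × Fin m => V p.1 p.2 ω),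
      (fun p : ℕ × Fin m × ℕ => I p.1 p.2.1 p.2.2 ω))) P

/-- The sample pool at level `j` output by the algorithm. -/
def pool (Q₀ : Fin m → Ω → ℝ) (V : ℕ → Fin m → Ω → BranchVec)
    (I : ℕ → Fin m → ℕ → Ω → Fin m) : ℕ → Ω → Fin m → ℝ
  | 0, ω, i => Q₀ i ω
  | j + 1, ω, i =>
      (∑ r ∈ Finset.range (BranchVec.N (V j i ω)),
        BranchVec.C (V j i ω) r * pool Q₀ V I j ω (I j i r ω))
      + BranchVec.Q (V j i ω)

/-- The empirical distribution `m⁻¹ ∑ δ_{x i}` of a pool. -/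
def empirical (x : Fin m → ℝ) : Measure ℝ :=
  (m : ℝ≥0∞)⁻¹ • ∑ i, Measure.dirac (x i)

end Algorithm

/-- The joint probability measures on `ℝ × ℝ` with marginals `μ` and `ν`. -/
def couplings (μ ν : Measure ℝ) : Set (Measure (ℝ × ℝ)) :=
  {π | IsProbabilityMeasure π ∧ π.map Prod.fst = μ ∧ π.map Prod.snd = ν}

/-- The Kantorovich–Rubinstein (Wasserstein-1) distance on the real line. -/
def d1 (μ ν : Measure ℝ) : ℝ≥0∞ :=
  ⨅ π ∈ couplings μ ν, ∫⁻ p, ENNReal.ofReal |p.1 - p.2| ∂π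

end IterBootstrap

end

/-
`F_k` is the `k`-th iterate of the smoothing transform, started from the law of `Q`. Given the pool
at level `j`, the next pool is an i.i.d. sample from the smoothing transform of the empirical
measure of that pool. On the line `d₁` is at most the `L¹` distance of the distribution functions,
attained by the quantile coupling; running one step of the recursion on quantile-coupled inputs with
a common branching vector multiplies the expected distance by at most `ρ₁`. The error `u_j` at
level `j` thus satisfies `u_{j+1} ≤ ρ₁ u_j + ε_{j+1}`, where `ε_{j+1}` is the error of the empirical
measure of `m` i.i.d. samples from `F_{j+1}`. The latter is `O(m^{-1+1/α})` as soon as the `α`-th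
moments of the `F_k` are bounded: at each threshold the error of the empirical distribution function
is at most its standard deviation, used near the origin, and at most twice the mean of the tail
indicator, used far out. In case (ii) the bound on the moments comes from the recursion for second
moments, whose cross terms vanish because all the `F_k` are centred.
-/

noncomputable section

namespace IterBootstrap

open Set Filter Topology

section Independence

variable {Ω : Type*} [MeasurableSpace Ω] {P : Measure Ω}

lemma iIndepFun_curry {ι κ E : Type*} [MeasurableSpace E] {X : ι × κ → Ω → E}
    (h : iIndepFun X P) (hX : ∀ p, Measurable (X p)) :
    iIndepFun (fun i ω k => X (i, k) ω) P := by
  have := h.isProbabilityMeasure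
  have hprob (i : ι) (k : κ) : IsProbabilityMeasure (P.map (X (i, k))) :=
    Measure.isProbabilityMeasure_map (hX _).aemeasurable
  rw [iIndepFun_iff_map_fun_eq_infinitePi_map fun i => measurable_pi_lambda _ fun k => hX (i, k)]
  have hrow (i : ι) : P.map (fun ω k => X (i, k) ω) =
      Measure.infinitePi fun k => P.map (X (i, k)) :=
    (h.precomp (Prod.mk_right_injective i)).map_fun_eq_infinitePi_map fun k => hX (i, k)
  simp only [hrow]
  rw [← Measure.infinitePi_map_curry fun i k => P.map (X (i, k)),
    ← h.map_fun_eq_infinitePi_map hX,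
    Measure.map_map (MeasurableEquiv.measurable _) (measurable_pi_lambda _ hX)]
  rfl

lemma indepFun_restrict_of_disjoint {ι : Type*} {E : ι → Type*} [∀ i, MeasurableSpace (E i)]
    {X : ∀ i, Ω → E i} (h : iIndepFun X P) (hX : ∀ i, Measurable (X i)) {s t : Set ι}
    (hst : Disjoint s t) :
    IndepFun (fun ω (i : s) => X i ω) (fun ω (i : t) => X i ω) P := by
  have hcomap (u : Set ι) : MeasurableSpace.comap (fun ω (i : u) => X i ω) MeasurableSpace.pi =
      ⨆ i ∈ u, MeasurableSpace.comap (X i) inferInstance := by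
    simp only [MeasurableSpace.pi, MeasurableSpace.comap_iSup, MeasurableSpace.comap_comp,
      iSup_subtype', Function.comp_def]
  rw [IndepFun_iff_Indep, hcomap, hcomap]
  exact indep_iSup_of_disjoint (fun i => (hX i).comap_le) h hst

variable {A B C : Type*} [MeasurableSpace A] [MeasurableSpace B] [MeasurableSpace C]

lemma indepFun_prodMk_left [IsProbabilityMeasure P] {X : Ω → A} {Y : Ω → B} {Z : Ω → C}
    (hX : Measurable X) (hY : Measurable Y) (hZ : Measurable Z)
    (h : IndepFun X (fun ω => (Y ω, Z ω)) P) (hYZ : IndepFun Y Z P) :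
    IndepFun (fun ω => (X ω, Y ω)) Z P := by
  have hXY : IndepFun X Y P := h.comp measurable_id measurable_fst
  have := Measure.isProbabilityMeasure_map (μ := P) hX.aemeasurable
  have := Measure.isProbabilityMeasure_map (μ := P) hY.aemeasurable
  have := Measure.isProbabilityMeasure_map (μ := P) hZ.aemeasurable
  rw [indepFun_iff_map_prod_eq_prod_map_map (by fun_prop) (by fun_prop)] at h hYZ hXY ⊢
  rw [hXY, ← (measurePreserving_prodAssoc _ _ _).symm.map_eq, ← hYZ, ← h,
    Measure.map_map (MeasurableEquiv.measurable _) (by fun_prop)]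
  rfl

variable {ι : Type*} {X : ι → Ω → A} {Y : ι → Ω → B}

lemma measure_biInter_preimage_inter_preimage (hX : iIndepFun X P) (hY : iIndepFun Y P)
    (hXY : IndepFun (fun ω i => X i ω) (fun ω i => Y i ω) P) (s : Finset ι) {S : ι → Set A}
    {T : ι → Set B} (hS : ∀ i ∈ s, MeasurableSet (S i)) (hT : ∀ i ∈ s, MeasurableSet (T i)) :
    P (⋂ i ∈ s, X i ⁻¹' S i ∩ Y i ⁻¹' T i) = ∏ i ∈ s, P (X i ⁻¹' S i ∩ Y i ⁻¹' T i) := by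
  have hpair {i : ι} (hi : i ∈ s) :
      P (X i ⁻¹' S i ∩ Y i ⁻¹' T i) = P (X i ⁻¹' S i) * P (Y i ⁻¹' T i) :=
    (hXY.comp (measurable_pi_apply i) (measurable_pi_apply i)).measure_inter_preimage_eq_mul
      _ _ (hS i hi) (hT i hi)
  have hall := hXY.measure_inter_preimage_eq_mul _ _
    (s.measurableSet_biInter fun i hi => measurable_pi_apply i (hS i hi))
    (s.measurableSet_biInter fun i hi => measurable_pi_apply i (hT i hi))
  simp only [preimage_iInter, preimage_preimage] at hall
  rw [Finset.prod_congr rfl fun i hi => hpair hi, Finset.prod_mul_distrib,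
    ← hX.measure_inter_preimage_eq_mul s hS, ← hY.measure_inter_preimage_eq_mul s hT]
  simp only [iInter_inter_distrib]
  exact hall

lemma iIndepFun_prodMk (hXm : ∀ i, Measurable (X i)) (hYm : ∀ i, Measurable (Y i))
    (hX : iIndepFun X P) (hY : iIndepFun Y P)
    (hXY : IndepFun (fun ω i => X i ω) (fun ω i => Y i ω) P) :
    iIndepFun (fun i ω => (X i ω, Y i ω)) P := by
  refine iIndepSets.iIndep (fun i => ((hXm i).prodMk (hYm i)).comap_le)
    (fun i => {s | ∃ t ∈ image2 (· ×ˢ ·)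
        {S : Set A | MeasurableSet S} {T : Set B | MeasurableSet T},
      (fun ω => (X i ω, Y i ω)) ⁻¹' t = s}) (fun i => isPiSystem_prod.comap _) (fun i => ?_) ?_
  · rw [← generateFrom_prod, MeasurableSpace.comap_generateFrom]
    rfl
  · rw [iIndepSets_iff]
    intro s f hf
    have hrect (i : ι) (hi : i ∈ s) : ∃ S T, MeasurableSet S ∧ MeasurableSet T ∧
        f i = X i ⁻¹' S ∩ Y i ⁻¹' T := by
      obtain ⟨_, ⟨S, hS, T, hT, rfl⟩, h⟩ := hf i hi
      exact ⟨S, T, hS, hT, h.symm⟩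
    choose! S T hS hT hST using hrect
    rw [iInter₂_congr hST, Finset.prod_congr rfl fun i hi => congrArg P (hST i hi)]
    exact measure_biInter_preimage_inter_preimage hX hY hXY s hS hT

end Independence

lemma measurable_sum_range {A M : Type*} [MeasurableSpace A] [MeasurableSpace M]
    [AddCommMonoid M] [MeasurableAdd₂ M] {N : A → ℕ} (hN : Measurable N) {f : ℕ → A → M}
    (hf : ∀ i, Measurable (f i)) : Measurable fun a => ∑ i ∈ Finset.range (N a), f i a :=
  (measurable_from_prod_countable_right (f := fun p : ℕ × A => ∑ i ∈ Finset.range p.1, f i p.2)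
    fun n => Finset.measurable_sum (Finset.range n) fun i _ => hf i).comp
      (hN.prodMk measurable_id)

@[fun_prop] lemma measurable_Q : Measurable BranchVec.Q := measurable_fst

@[fun_prop] lemma measurable_N : Measurable BranchVec.N := measurable_snd.fst

@[fun_prop] lemma measurable_C (r : ℕ) : Measurable fun v => BranchVec.C v r :=
  (measurable_pi_apply r).comp measurable_snd.snd

/-- The value `∑_{r < N} C_r x_r + Q` of a node with branching vector `v` whose children have
the values `x r`. -/
def step (v : BranchVec) (x : ℕ → ℝ) : ℝ :=
  (∑ r ∈ Finset.range (BranchVec.N v), BranchVec.C v r * x r) + BranchVec.Q v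

lemma measurable_step : Measurable fun p : BranchVec × (ℕ → ℝ) => step p.1 p.2 :=
  (measurable_sum_range (measurable_N.comp measurable_fst) fun r =>
    ((measurable_C r).comp measurable_fst).mul
      ((measurable_pi_apply r).comp measurable_snd)).add (measurable_Q.comp measurable_fst)

/-- The law of `∑_{r < N} C_r X_r + Q` for i.i.d. `X_r` with law `ν`, independent of the
branching vector: the smoothing transform of `ν`. -/
def smoothing (μ : Measure BranchVec) (ν : Measure ℝ) : Measure ℝ :=
  (μ.prod (Measure.infinitePi fun _ : ℕ => ν)).map fun p => step p.1 p.2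

instance (μ : Measure BranchVec) [IsProbabilityMeasure μ] (ν : Measure ℝ)
    [IsProbabilityMeasure ν] : IsProbabilityMeasure (smoothing μ ν) :=
  Measure.isProbabilityMeasure_map measurable_step.aemeasurable

/-- The iterates of the smoothing transform from the law of `Q`; `lawR μ k` is the law `F_k` of
`R^{(k)}`. -/
def lawR (μ : Measure BranchVec) : ℕ → Measure ℝ
  | 0 => μ.map BranchVec.Q
  | k + 1 => smoothing μ (lawR μ k)

instance (μ : Measure BranchVec) [IsProbabilityMeasure μ] (k : ℕ) :
    IsProbabilityMeasure (lawR μ k) := by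
  induction k with
  | zero => exact Measure.isProbabilityMeasure_map measurable_Q.aemeasurable
  | succ k ih => exact inferInstanceAs (IsProbabilityMeasure (smoothing μ (lawR μ k)))

section Tree

variable {Ω : Type*}

lemma generation_succ_eq_biUnion_root (V : List ℕ → Ω → BranchVec) (ω : Ω) (n : ℕ) :
    generation V ω (n + 1) = (Finset.range (BranchVec.N (V [] ω))).biUnion fun r =>
      (generation (fun i => V (i ++ [r])) ω n).image fun i => i ++ [r] := by
  induction n with
  | zero => ext l; simp [generation, eq_comm]
  | succ n ih =>
    rw [generation, ih]
    ext l
    simp only [generation, Finset.mem_biUnion, Finset.mem_image]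
    constructor
    · rintro ⟨_, ⟨r, hr, i, hi, rfl⟩, q, hq, rfl⟩
      exact ⟨r, hr, q :: i, ⟨i, hi, q, hq, rfl⟩, rfl⟩
    · rintro ⟨r, hr, _, ⟨i, hi, q, hq, rfl⟩, rfl⟩
      exact ⟨i ++ [r], ⟨r, hr, i, hi, rfl⟩, q, hq, rfl⟩

lemma weight_append_singleton (V : List ℕ → Ω → BranchVec) (ω : Ω) (r : ℕ) (i : List ℕ) :
    weight V ω (i ++ [r]) =
      BranchVec.C (V [] ω) r * weight (fun i => V (i ++ [r])) ω i := by
  induction i with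
  | nil => simp [weight]
  | cons q i ih => simp only [List.cons_append, weight, ih]; ring

lemma sum_generation_succ (V : List ℕ → Ω → BranchVec) (ω : Ω) (n : ℕ) (f : List ℕ → ℝ) :
    ∑ i ∈ generation V ω (n + 1), f i = ∑ r ∈ Finset.range (BranchVec.N (V [] ω)),
      ∑ i ∈ generation (fun i => V (i ++ [r])) ω n, f (i ++ [r]) := by
  rw [generation_succ_eq_biUnion_root, Finset.sum_biUnion]
  · exact Finset.sum_congr rfl fun r _ =>
      Finset.sum_image fun a _ b _ h => List.append_cancel_right h
  · intro a _ b _ hab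
    rw [Function.onFun, Finset.disjoint_left]
    intro l hl hl'
    obtain ⟨i, _, rfl⟩ := Finset.mem_image.1 hl
    obtain ⟨i', _, h⟩ := Finset.mem_image.1 hl'
    exact hab (by simpa using (List.append_inj' h rfl).2.symm)

lemma R_zero (V : List ℕ → Ω → BranchVec) (ω : Ω) : R V 0 ω = BranchVec.Q (V [] ω) := by
  simp [R, generation, weight]

lemma R_succ (V : List ℕ → Ω → BranchVec) (k : ℕ) (ω : Ω) :
    R V (k + 1) ω = step (V [] ω) fun r => R (fun i => V (i ++ [r])) k ω := by
  rw [R, Finset.sum_range_succ', step]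
  congr 1
  · simp only [R, Finset.mul_sum, sum_generation_succ, weight_append_singleton]
    rw [Finset.sum_comm]
    refine Finset.sum_congr rfl fun r _ => Finset.sum_congr rfl fun j _ =>
      Finset.sum_congr rfl fun i _ => ?_
    ring
  · simp [generation, weight]

/-- `R^{(k)}` as a function of the whole tree `z` of branching vectors. -/
def treeR : ℕ → (List ℕ → BranchVec) → ℝ
  | 0, z => BranchVec.Q (z [])
  | k + 1, z => step (z []) fun r => treeR k fun i => z (i ++ [r])

lemma R_eq_treeR (V : List ℕ → Ω → BranchVec) (k : ℕ) (ω : Ω) :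
    R V k ω = treeR k fun i => V i ω := by
  induction k generalizing V with
  | zero => exact R_zero V ω
  | succ k ih => simp only [R_succ, treeR, ih]

lemma measurable_treeR (k : ℕ) : Measurable (treeR k) := by
  induction k with
  | zero => exact measurable_Q.comp (measurable_pi_apply [])
  | succ k ih =>
    have hchildren : Measurable fun (z : List ℕ → BranchVec) (r : ℕ) =>
        treeR k fun i => z (i ++ [r]) :=
      measurable_pi_lambda _ fun r => ih.comp (by fun_prop)
    exact measurable_step.comp ((measurable_pi_apply []).prodMk hchildren)

namespace IsBranchingFamily

variable [MeasurableSpace Ω] {μ : Measure BranchVec} {P : Measure Ω}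
  {V : List ℕ → Ω → BranchVec}

lemma subtree (h : IsBranchingFamily μ P V) (r : ℕ) :
    IsBranchingFamily μ P fun i => V (i ++ [r]) where
  measurable _ := h.measurable _
  law _ := h.law _
  indep := h.indep.precomp (List.append_left_injective [r])

lemma measurable_R (h : IsBranchingFamily μ P V) (k : ℕ) : Measurable (R V k) := by
  rw [funext fun ω => R_eq_treeR V k ω]
  exact (measurable_treeR k).comp (measurable_pi_lambda _ h.measurable)

lemma iIndepFun_R_subtree (h : IsBranchingFamily μ P V) (k : ℕ) :
    iIndepFun (fun r => R (fun i => V (i ++ [r])) k) P := by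
  have hinj : Function.Injective fun p : ℕ × List ℕ => p.2 ++ [p.1] := fun p q hpq => by
    obtain ⟨h₁, h₂⟩ := List.append_inj' hpq rfl
    exact Prod.ext (List.singleton_injective h₂) h₁
  have hnodes : iIndepFun (fun p : ℕ × List ℕ => V (p.2 ++ [p.1])) P := h.indep.precomp hinj
  have hsub := iIndepFun_curry hnodes fun _ => h.measurable _
  rw [funext fun r => funext (R_eq_treeR (fun i => V (i ++ [r])) k)]
  exact hsub.comp (fun _ => treeR k) fun _ => measurable_treeR k

lemma indepFun_root_R_subtree (h : IsBranchingFamily μ P V) (k : ℕ) :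
    IndepFun (V []) (fun ω r => R (fun i => V (i ++ [r])) k ω) P := by
  have hsplit := indepFun_restrict_of_disjoint h.indep h.measurable
    (disjoint_compl_right (a := ({[]} : Set (List ℕ))))
  have hchild (r : ℕ) (i : List ℕ) : i ++ [r] ∈ ({[]} : Set (List ℕ))ᶜ := by simp
  simp only [R_eq_treeR]
  exact hsplit.comp (measurable_pi_apply ⟨[], rfl⟩)
    (ψ := fun z r => treeR k fun i => z ⟨i ++ [r], hchild r i⟩)
    (measurable_pi_lambda _ fun r => (measurable_treeR k).comp
      (measurable_pi_lambda _ fun i => measurable_pi_apply _))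

lemma map_R (h : IsBranchingFamily μ P V) (k : ℕ) : P.map (R V k) = lawR μ k := by
  have := h.indep.isProbabilityMeasure
  induction k generalizing V with
  | zero =>
    rw [funext (R_zero V), lawR, ← h.law [], Measure.map_map measurable_Q (h.measurable [])]
    rfl
  | succ k ih =>
    have hchildren := (h.iIndepFun_R_subtree k).map_fun_eq_infinitePi_map
      fun r => (h.subtree r).measurable_R k
    have hroot := (indepFun_iff_map_prod_eq_prod_map_map (h.measurable []).aemeasurable
      (measurable_pi_lambda _ fun r => (h.subtree r).measurable_R k).aemeasurable).1
      (h.indepFun_root_R_subtree k)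
    simp only [hchildren, h.law, ih (h.subtree _)] at hroot
    rw [funext (R_succ V k), lawR, smoothing, ← hroot, Measure.map_map measurable_step
      ((h.measurable []).prodMk (measurable_pi_lambda _ fun r => (h.subtree r).measurable_R k))]
    rfl

end IsBranchingFamily

end Tree

section CdfDist

/-- The `L¹` distance of the distribution functions of two measures on the real line. -/
def cdfDist (μ ν : Measure ℝ) : ℝ≥0∞ :=
  ∫⁻ t, ‖μ.real (Iic t) - ν.real (Iic t)‖ₑ

@[fun_prop] lemma measurable_real_Iic (μ : Measure ℝ) [IsFiniteMeasure μ] :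
    Measurable fun t => μ.real (Iic t) :=
  Monotone.measurable fun _ _ h => measureReal_mono (Iic_subset_Iic.2 h)

lemma cdfDist_triangle (μ ν κ : Measure ℝ) [IsFiniteMeasure μ] [IsFiniteMeasure ν] :
    cdfDist μ κ ≤ cdfDist μ ν + cdfDist ν κ := by
  rw [cdfDist, cdfDist, cdfDist, ← lintegral_add_left (by fun_prop)]
  refine lintegral_mono fun t => ?_
  simp only [← edist_eq_enorm_sub]
  exact edist_triangle _ _ _

lemma lintegral_enorm_indicator_Iic_sub (a b : ℝ) :
    ∫⁻ t, ‖(Iic a).indicator (1 : ℝ → ℝ) t - (Iic b).indicator 1 t‖ₑ = ‖a - b‖ₑ := by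
  wlog h : a ≤ b generalizing a b
  · simpa only [enorm_sub_rev] using this b a (le_of_not_ge h)
  have hdiff (t : ℝ) : ‖(Iic a).indicator (1 : ℝ → ℝ) t - (Iic b).indicator 1 t‖ₑ =
      (Ioc a b).indicator 1 t := by
    by_cases ha : t ≤ a
    · simp [ha, ha.trans h]
    · by_cases hb : t ≤ b <;> simp [ha, hb, not_le.1 ha]
  rw [lintegral_congr hdiff, lintegral_indicator_one measurableSet_Ioc, Real.volume_Ioc,
    enorm_sub_rev, Real.enorm_of_nonneg (sub_nonneg.2 h)]

lemma lintegral_enorm_indicator_Ici_sub (a b : ℝ) :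
    ∫⁻ t, ‖(Ici a).indicator (1 : ℝ → ℝ) t - (Ici b).indicator 1 t‖ₑ = ‖a - b‖ₑ := by
  have hneg (c t : ℝ) : (Ici c).indicator (1 : ℝ → ℝ) t = (Iic (-c)).indicator 1 (-t) := by
    simp [indicator]
  simp only [hneg]
  rw [lintegral_neg_eq_self (μ := volume) fun t : ℝ =>
    ‖(Iic (-a)).indicator (1 : ℝ → ℝ) t - (Iic (-b)).indicator 1 t‖ₑ,
    lintegral_enorm_indicator_Iic_sub, neg_sub_neg, enorm_sub_rev]

/-- The quantile function of a measure on the real line, set to `0` outside `(0, 1)`, where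
the infimum would be over an empty or unbounded set. -/
def quantile (ν : Measure ℝ) (u : ℝ) : ℝ :=
  (Ioo 0 1).indicator (fun u => sInf {t | u ≤ ν.real (Iic t)}) u

lemma quantile_le_iff (ν : Measure ℝ) [IsProbabilityMeasure ν] {u : ℝ} (hu : u ∈ Ioo (0 : ℝ) 1)
    (t : ℝ) : quantile ν u ≤ t ↔ u ≤ ν.real (Iic t) := by
  rw [quantile, indicator_of_mem hu]
  simp only [← cdf_eq_real]
  have hb : BddBelow {t | u ≤ cdf ν t} := by
    obtain ⟨s, hs⟩ := ((tendsto_cdf_atBot ν).eventually (gt_mem_nhds hu.1)).exists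
    refine ⟨s, fun r hr => le_of_not_gt fun hlt => ?_⟩
    exact absurd (hr.trans (monotone_cdf ν hlt.le)) (not_le.2 hs)
  have hne : {t | u ≤ cdf ν t}.Nonempty := by
    obtain ⟨s, hs⟩ := ((tendsto_cdf_atTop ν).eventually (lt_mem_nhds hu.2)).exists
    exact ⟨s, hs.le⟩
  refine ⟨fun h => ?_, fun h => csInf_le hb h⟩
  have hc : Tendsto (cdf ν) (𝓝[>] t) (𝓝 (cdf ν t)) :=
    ((cdf ν).right_continuous t).mono_left (nhdsWithin_mono _ Ioi_subset_Ici_self)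
  refine ge_of_tendsto hc (eventually_nhdsWithin_of_forall fun s hs => ?_)
  obtain ⟨r, hr, hrs⟩ := (csInf_lt_iff hb hne).1 (h.trans_lt hs)
  exact le_trans hr (monotone_cdf ν hrs.le)

lemma quantile_preimage_Iic_inter_Ioo (ν : Measure ℝ) [IsProbabilityMeasure ν] (t : ℝ) :
    quantile ν ⁻¹' Iic t ∩ Ioo 0 1 = Iic (ν.real (Iic t)) ∩ Ioo 0 1 := by
  ext u
  exact and_congr_left fun hu => quantile_le_iff ν hu t

@[fun_prop] lemma measurable_quantile (ν : Measure ℝ) [IsProbabilityMeasure ν] :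
    Measurable (quantile ν) := by
  refine measurable_of_restrict_of_restrict_compl (s := Ioo 0 1) measurableSet_Ioo ?_ ?_
  · refine measurable_of_Iic fun t => ?_
    have hpre : (Ioo 0 1).domRestrict (quantile ν) ⁻¹' Iic t =
        Subtype.val ⁻¹' Iic (ν.real (Iic t)) := by
      ext u
      exact quantile_le_iff ν u.2 t
    exact hpre ▸ measurable_subtype_coe measurableSet_Iic
  · have hzero : (Ioo 0 1)ᶜ.domRestrict (quantile ν) = 0 := by
      ext u
      rw [domRestrict_apply, quantile, indicator_of_notMem u.2, Pi.zero_apply]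
    exact hzero ▸ measurable_zero

instance : IsProbabilityMeasure ((volume : Measure ℝ).restrict (Ioo 0 1)) := ⟨by simp⟩

lemma map_quantile (ν : Measure ℝ) [IsProbabilityMeasure ν] :
    ((volume : Measure ℝ).restrict (Ioo 0 1)).map (quantile ν) = ν := by
  have := Measure.isProbabilityMeasure_map (μ := (volume : Measure ℝ).restrict (Ioo 0 1))
    (measurable_quantile ν).aemeasurable
  refine Measure.ext_of_Iic _ _ fun t => ?_
  rw [Measure.map_apply (measurable_quantile ν) measurableSet_Iic,
    Measure.restrict_apply (measurable_quantile ν measurableSet_Iic),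
    quantile_preimage_Iic_inter_Ioo, measure_congr ((ae_eq_refl _).inter Ioo_ae_eq_Ioc),
    inter_comm, Ioc_inter_Iic, min_eq_right measureReal_le_one, Real.volume_Ioc, sub_zero,
    ofReal_measureReal]

/-- The joint law of the quantile functions of `μ` and `ν` at a uniform point of `(0, 1)`. -/
def quantileCoupling (μ ν : Measure ℝ) : Measure (ℝ × ℝ) :=
  ((volume : Measure ℝ).restrict (Ioo 0 1)).map fun u => (quantile μ u, quantile ν u)

lemma quantileCoupling_mem_couplings (μ ν : Measure ℝ) [IsProbabilityMeasure μ]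
    [IsProbabilityMeasure ν] : quantileCoupling μ ν ∈ couplings μ ν := by
  refine ⟨Measure.isProbabilityMeasure_map (by fun_prop), ?_, ?_⟩
  · rw [quantileCoupling, Measure.map_map measurable_fst (by fun_prop)]
    exact map_quantile μ
  · rw [quantileCoupling, Measure.map_map measurable_snd (by fun_prop)]
    exact map_quantile ν

lemma measurable_indicator_Ici_uncurry :
    Measurable fun p : ℝ × ℝ => (Ici p.1).indicator (1 : ℝ → ℝ) p.2 :=
  (measurable_one.indicator (measurableSet_le measurable_fst measurable_snd) :
    Measurable ({p : ℝ × ℝ | p.1 ≤ p.2}.indicator (1 : ℝ × ℝ → ℝ)))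

lemma lintegral_enorm_quantileCoupling_le (μ ν : Measure ℝ) [IsProbabilityMeasure μ]
    [IsProbabilityMeasure ν] :
    ∫⁻ p, ‖p.1 - p.2‖ₑ ∂quantileCoupling μ ν ≤ cdfDist μ ν := by
  have hmeas (κ : Measure ℝ) [IsProbabilityMeasure κ] :
      Measurable fun p : ℝ × ℝ => (Ici (quantile κ p.1)).indicator (1 : ℝ → ℝ) p.2 :=
    measurable_indicator_Ici_uncurry.comp
      (((measurable_quantile κ).comp measurable_fst).prodMk measurable_snd)
  have hslice (t u : ℝ) (hu : u ∈ Ioo (0 : ℝ) 1) (κ : Measure ℝ) [IsProbabilityMeasure κ] :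
      (Ici (quantile κ u)).indicator (1 : ℝ → ℝ) t =
        (Iic (κ.real (Iic t))).indicator 1 u := by
    simp only [indicator, mem_Ici, mem_Iic, quantile_le_iff κ hu t, Pi.one_apply]
  calc ∫⁻ p, ‖p.1 - p.2‖ₑ ∂quantileCoupling μ ν
      = ∫⁻ u in Ioo 0 1, ‖quantile μ u - quantile ν u‖ₑ :=
        lintegral_map (by fun_prop) (by fun_prop)
    _ = ∫⁻ u in Ioo 0 1, ∫⁻ t, ‖(Ici (quantile μ u)).indicator (1 : ℝ → ℝ) t -
          (Ici (quantile ν u)).indicator 1 t‖ₑ := by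
        simp only [lintegral_enorm_indicator_Ici_sub]
    _ = ∫⁻ t, ∫⁻ u in Ioo 0 1, ‖(Ici (quantile μ u)).indicator (1 : ℝ → ℝ) t -
          (Ici (quantile ν u)).indicator 1 t‖ₑ :=
        lintegral_lintegral_swap ((hmeas μ).sub (hmeas ν)).enorm.aemeasurable
    _ = ∫⁻ t, ∫⁻ u in Ioo 0 1, ‖(Iic (μ.real (Iic t))).indicator (1 : ℝ → ℝ) u -
          (Iic (ν.real (Iic t))).indicator 1 u‖ₑ :=
        lintegral_congr fun t => setLIntegral_congr_fun measurableSet_Ioo fun u hu => by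
          simp only [hslice t u hu]
    _ ≤ ∫⁻ t, ‖μ.real (Iic t) - ν.real (Iic t)‖ₑ := lintegral_mono fun t =>
        (setLIntegral_le_lintegral _ _).trans_eq (lintegral_enorm_indicator_Iic_sub _ _)

lemma d1_le_cdfDist (μ ν : Measure ℝ) [IsProbabilityMeasure μ] [IsProbabilityMeasure ν] :
    d1 μ ν ≤ cdfDist μ ν := by
  simpa only [d1, ← Real.enorm_eq_ofReal_abs] using
    (iInf₂_le _ (quantileCoupling_mem_couplings μ ν)).trans
      (lintegral_enorm_quantileCoupling_le μ ν)

end CdfDist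

section Empirical

variable {m : ℕ}

lemma empirical_apply (x : Fin m → ℝ) {s : Set ℝ} (hs : MeasurableSet s) :
    empirical x s = (m : ℝ≥0∞)⁻¹ * ∑ i, s.indicator 1 (x i) := by
  simp [empirical, Measure.dirac_apply' _ hs]

instance [NeZero m] (x : Fin m → ℝ) : IsProbabilityMeasure (empirical x) := by
  refine ⟨?_⟩
  rw [empirical_apply x .univ]
  simpa using ENNReal.inv_mul_cancel (by simp [NeZero.ne m]) (ENNReal.natCast_ne_top m)

lemma empirical_real (x : Fin m → ℝ) {s : Set ℝ} (hs : MeasurableSet s) :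
    (empirical x).real s = (m : ℝ)⁻¹ * ∑ i, s.indicator 1 (x i) := by
  have hind (i : Fin m) : s.indicator (1 : ℝ → ℝ≥0∞) (x i) =
      ENNReal.ofReal (s.indicator 1 (x i)) := by
    by_cases h : x i ∈ s <;> simp [h]
  have hnonneg (i : Fin m) : 0 ≤ s.indicator (1 : ℝ → ℝ) (x i) :=
    indicator_nonneg (fun _ _ => zero_le_one) _
  rw [measureReal_def, empirical_apply x hs, Finset.sum_congr rfl fun i _ => hind i,
    ← ENNReal.ofReal_sum_of_nonneg fun i _ => hnonneg i, ENNReal.toReal_mul,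
    ENNReal.toReal_ofReal (Finset.sum_nonneg fun i _ => hnonneg i), ENNReal.toReal_inv,
    ENNReal.toReal_natCast]

lemma map_uniformOn_univ (x : Fin m → ℝ) :
    (uniformOn (univ : Set (Fin m))).map x = empirical x := by
  have hsum : (Measure.count : Measure (Fin m)).map x = ∑ i, Measure.dirac (x i) := by
    rw [Measure.count, Measure.map_sum (measurable_of_finite x).aemeasurable, Measure.sum_fintype]
    exact Finset.sum_congr rfl fun i _ => Measure.map_dirac' (measurable_of_finite x) i
  rw [uniformOn, ProbabilityTheory.cond, Measure.restrict_univ, Measure.map_smul, hsum,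
    Measure.count_univ, ENat.card_eq_coe_fintype_card, Fintype.card_fin, empirical]
  rfl

lemma cdfDist_empirical_le (x y : Fin m → ℝ) :
    cdfDist (empirical x) (empirical y) ≤ (m : ℝ≥0∞)⁻¹ * ∑ i, ‖x i - y i‖ₑ := by
  have hmeas (i : Fin m) : Measurable fun t =>
      ‖(Ici (x i)).indicator (1 : ℝ → ℝ) t - (Ici (y i)).indicator 1 t‖ₑ :=
    ((measurable_one.indicator measurableSet_Ici).sub
      (measurable_one.indicator measurableSet_Ici)).enorm
  have hswap (a t : ℝ) : (Iic t).indicator (1 : ℝ → ℝ) a = (Ici a).indicator 1 t := by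
    simp [indicator]
  have hm : ‖(m : ℝ)⁻¹‖ₑ ≤ (m : ℝ≥0∞)⁻¹ := by
    rcases m.eq_zero_or_pos with rfl | hm
    · simp
    · rw [enorm_inv (by positivity), Real.enorm_natCast]
  rw [Finset.sum_congr rfl fun i _ => (lintegral_enorm_indicator_Ici_sub (x i) (y i)).symm,
    ← lintegral_finsetSum _ fun i _ => hmeas i,
    ← lintegral_const_mul _ (Finset.measurable_sum _ fun i _ => hmeas i)]
  refine lintegral_mono fun t => ?_
  rw [empirical_real x measurableSet_Iic, empirical_real y measurableSet_Iic, ← mul_sub,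
    ← Finset.sum_sub_distrib, enorm_mul]
  simp only [hswap]
  exact mul_le_mul' hm (enorm_sum_le _ _)

lemma measurable_empirical_real_Iic_sub (ν : Measure ℝ) [IsFiniteMeasure ν] :
    Measurable fun p : (Fin m → ℝ) × ℝ => (empirical p.1).real (Iic p.2) - ν.real (Iic p.2) := by
  have hind (i : Fin m) : Measurable fun p : (Fin m → ℝ) × ℝ =>
      (Iic p.2).indicator (1 : ℝ → ℝ) (p.1 i) :=
    measurable_indicator_Ici_uncurry.comp (f := fun p : (Fin m → ℝ) × ℝ => (p.1 i, p.2))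
      (by fun_prop)
  simp only [empirical_real _ measurableSet_Iic]
  exact ((Finset.measurable_sum _ fun i _ => hind i).const_mul _).sub
    ((measurable_real_Iic ν).comp measurable_snd)

lemma measurable_cdfDist_empirical (ν : Measure ℝ) [IsFiniteMeasure ν] :
    Measurable fun x : Fin m → ℝ => cdfDist (empirical x) ν :=
  (measurable_empirical_real_Iic_sub ν).enorm.lintegral_prod_right'

end Empirical

section EmpiricalRate

open scoped NNReal

lemma lintegral_enorm_sub_integral_le_sqrt_variance {Ω : Type*} [MeasurableSpace Ω]
    {P : Measure Ω} [IsProbabilityMeasure P] {X : Ω → ℝ} (hX : MemLp X 2 P) :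
    ∫⁻ ω, ‖X ω - P[X]‖ₑ ∂P ≤ ENNReal.ofReal √(Var[X; P]) := by
  have hmono := eLpNorm_le_eLpNorm_of_exponent_le one_le_two
    (hX.sub (memLp_const P[X])).aestronglyMeasurable
  rw [eLpNorm_one_eq_lintegral_enorm] at hmono
  refine hmono.trans_eq ?_
  rw [eLpNorm_eq_lintegral_rpow_enorm_toReal two_ne_zero ENNReal.ofNat_ne_top,
    Real.sqrt_eq_rpow, ← ENNReal.ofReal_rpow_of_nonneg (variance_nonneg X P) (by norm_num),
    hX.ofReal_variance_eq, evariance]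
  simp

section SampleMean

variable {E : Type*} [MeasurableSpace E] {m : ℕ} [NeZero m] (F : Measure E)
  [IsProbabilityMeasure F] {f : E → ℝ}

lemma integral_sampleMean (hf : Integrable f F) :
    ∫ y, (m : ℝ)⁻¹ * ∑ i, f (y i) ∂(Measure.pi fun _ : Fin m => F) = ∫ z, f z ∂F := by
  rw [integral_const_mul, integral_finsetSum _ fun i _ => integrable_comp_eval hf]
  simp only [integral_comp_eval (μ := fun _ : Fin m => F) hf.aestronglyMeasurable]
  simp [NeZero.ne m]

lemma variance_sampleMean (hf : MemLp f 2 F) :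
    Var[fun y => (m : ℝ)⁻¹ * ∑ i, f (y i); Measure.pi fun _ : Fin m => F] = Var[f; F] / m := by
  have hsum := variance_sum_pi (μ := fun _ : Fin m => F) (X := fun _ => f) fun _ => hf
  simp only [Finset.sum_fn, Finset.sum_const, Finset.card_univ, Fintype.card_fin,
    nsmul_eq_mul] at hsum
  rw [variance_const_mul, hsum]
  have := NeZero.ne m
  field_simp

lemma lintegral_enorm_sampleMean_sub_le_sqrt (hf : MemLp f 2 F) :
    ∫⁻ y, ‖(m : ℝ)⁻¹ * ∑ i, f (y i) - ∫ z, f z ∂F‖ₑ ∂(Measure.pi fun _ : Fin m => F) ≤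
      ENNReal.ofReal √(Var[f; F] / m) := by
  have hmean : MemLp (fun y : Fin m → E => (m : ℝ)⁻¹ * ∑ i, f (y i)) 2
      (Measure.pi fun _ : Fin m => F) :=
    (memLp_finsetSum _ fun i _ =>
      hf.comp_measurePreserving (measurePreserving_eval (fun _ => F) i)).const_mul _
  have h := lintegral_enorm_sub_integral_le_sqrt_variance hmean
  rwa [integral_sampleMean F (hf.integrable one_le_two), variance_sampleMean F hf] at h

lemma lintegral_enorm_sampleMean_sub_le (c : ℝ) (hf : Measurable f) :
    ∫⁻ y, ‖(m : ℝ)⁻¹ * ∑ i, f (y i) - c‖ₑ ∂(Measure.pi fun _ : Fin m => F) ≤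
      ∫⁻ z, ‖f z - c‖ₑ ∂F := by
  have hm := NeZero.ne m
  have hcenter (y : Fin m → E) : (m : ℝ)⁻¹ * ∑ i, f (y i) - c = (m : ℝ)⁻¹ * ∑ i, (f (y i) - c) := by
    simp only [Finset.sum_sub_distrib, Finset.sum_const, Finset.card_univ, Fintype.card_fin,
      nsmul_eq_mul]
    field_simp
  have heval (i : Fin m) : ∫⁻ y, ‖f (y i) - c‖ₑ ∂(Measure.pi fun _ : Fin m => F) =
      ∫⁻ z, ‖f z - c‖ₑ ∂F :=
    (measurePreserving_eval (fun _ => F) i).lintegral_comp (f := fun z => ‖f z - c‖ₑ)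
      (by fun_prop)
  calc ∫⁻ y, ‖(m : ℝ)⁻¹ * ∑ i, f (y i) - c‖ₑ ∂(Measure.pi fun _ : Fin m => F)
      ≤ ∫⁻ y, ‖(m : ℝ)⁻¹‖ₑ * ∑ i, ‖f (y i) - c‖ₑ ∂(Measure.pi fun _ : Fin m => F) := by
        refine lintegral_mono fun y => ?_
        simp only [hcenter, enorm_mul]
        gcongr
        exact enorm_sum_le _ _
    _ = (m : ℝ≥0∞)⁻¹ * ∑ _i : Fin m, ∫⁻ z, ‖f z - c‖ₑ ∂F := by
        rw [lintegral_const_mul _ (by fun_prop), lintegral_finsetSum _ fun i _ => by fun_prop,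
          Finset.sum_congr rfl fun i _ => heval i, enorm_inv (by positivity), Real.enorm_natCast]
    _ = ∫⁻ z, ‖f z - c‖ₑ ∂F := by
        rw [Finset.sum_const, Finset.card_univ, Fintype.card_fin, nsmul_eq_mul,
          ENNReal.inv_mul_cancel_left' (by simp [hm]) (by simp)]

end SampleMean

section Indicator

variable {E : Type*} [MeasurableSpace E] (F : Measure E) {s : Set E}

lemma memLp_indicator_one [IsFiniteMeasure F] (p : ℝ≥0∞) (hs : MeasurableSet s) :
    MemLp (s.indicator (1 : E → ℝ)) p F :=
  memLp_indicator_const p hs 1 (Or.inr (measure_ne_top F s))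

variable [IsProbabilityMeasure F]

lemma variance_indicator_one (hs : MeasurableSet s) :
    Var[s.indicator 1; F] = F.real s * F.real sᶜ := by
  have hsq : (s.indicator (1 : E → ℝ)) ^ 2 = s.indicator 1 := by
    ext z
    by_cases h : z ∈ s <;> simp [h]
  rw [variance_eq_sub (memLp_indicator_one F 2 hs), hsq, integral_indicator_one hs,
    probReal_compl_eq_one_sub hs]
  ring

lemma lintegral_enorm_indicator_one_sub (hs : MeasurableSet s) :
    ∫⁻ z, ‖s.indicator 1 z - F.real s‖ₑ ∂F = ENNReal.ofReal (2 * (F.real s * F.real sᶜ)) := by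
  have hcompl := probReal_compl_eq_one_sub (μ := F) hs
  have h1 : ∫⁻ z in s, ‖s.indicator 1 z - F.real s‖ₑ ∂F = ‖F.real sᶜ‖ₑ * F s := by
    rw [← setLIntegral_const]
    exact setLIntegral_congr_fun hs fun z hz => by simp [hz, hcompl]
  have h2 : ∫⁻ z in sᶜ, ‖s.indicator 1 z - F.real s‖ₑ ∂F = ‖F.real s‖ₑ * F sᶜ := by
    rw [← setLIntegral_const]
    exact setLIntegral_congr_fun hs.compl fun z hz => by simp [notMem_of_mem_compl hz]
  rw [← lintegral_add_compl _ hs, h1, h2, Real.enorm_of_nonneg measureReal_nonneg,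
    Real.enorm_of_nonneg measureReal_nonneg, ← ofReal_measureReal, ← ofReal_measureReal,
    ← ENNReal.ofReal_mul measureReal_nonneg, ← ENNReal.ofReal_mul measureReal_nonneg,
    ← ENNReal.ofReal_add (by positivity) (by positivity)]
  congr 1
  ring

end Indicator

section EmpiricalMeasure

variable {m : ℕ} [NeZero m] (F : Measure ℝ) [IsProbabilityMeasure F] {s : Set ℝ}

lemma lintegral_enorm_empirical_sub_le_sqrt (hs : MeasurableSet s) :
    ∫⁻ y, ‖(empirical y).real s - F.real s‖ₑ ∂(Measure.pi fun _ : Fin m => F) ≤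
      ENNReal.ofReal √(F.real s * F.real sᶜ / m) := by
  simpa only [empirical_real _ hs, integral_indicator_one hs, variance_indicator_one F hs] using
    lintegral_enorm_sampleMean_sub_le_sqrt (m := m) F (memLp_indicator_one F 2 hs)

lemma lintegral_enorm_empirical_sub_le (hs : MeasurableSet s) :
    ∫⁻ y, ‖(empirical y).real s - F.real s‖ₑ ∂(Measure.pi fun _ : Fin m => F) ≤
      ENNReal.ofReal (2 * (F.real s * F.real sᶜ)) := by
  simpa only [empirical_real _ hs, lintegral_enorm_indicator_one_sub F hs] using
    lintegral_enorm_sampleMean_sub_le (m := m) F (F.real s) (measurable_one.indicator hs)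

end EmpiricalMeasure

section Tail

variable {F : Measure ℝ} {α : ℝ} {M : ℝ≥0}

lemma real_abs_ge_le_mul_rpow_neg (hα : 0 < α) (hF : ∫⁻ x, ‖x‖ₑ ^ α ∂F ≤ M) {r : ℝ}
    (hr : 0 < r) : F.real {x | r ≤ |x|} ≤ M * r ^ (-α) := by
  refine ENNReal.toReal_le_of_le_ofReal (by positivity) ?_
  have hmarkov := meas_ge_le_lintegral_div (μ := F) (f := fun x : ℝ => ‖x‖ₑ ^ α)
    (ε := ENNReal.ofReal r ^ α) (by fun_prop) (by positivity) (by finiteness)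
  have hset : {x : ℝ | ENNReal.ofReal r ^ α ≤ ‖x‖ₑ ^ α} = {x | r ≤ |x|} := by
    ext x
    simp only [mem_ofPred_eq, ENNReal.rpow_le_rpow_iff hα, Real.enorm_eq_ofReal_abs,
      ENNReal.ofReal_le_ofReal_iff (abs_nonneg x)]
  rw [hset] at hmarkov
  refine hmarkov.trans ((ENNReal.div_le_div_right hF _).trans_eq ?_)
  rw [ENNReal.ofReal_mul M.coe_nonneg, Real.rpow_neg hr.le,
    ENNReal.ofReal_inv_of_pos (by positivity), ENNReal.ofReal_rpow_of_pos hr,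
    ENNReal.ofReal_coe_nnreal, div_eq_mul_inv]

lemma real_Iic_mul_compl_le [IsProbabilityMeasure F] (hα : 0 < α) (hF : ∫⁻ x, ‖x‖ₑ ^ α ∂F ≤ M)
    {t : ℝ} (ht : t ≠ 0) : F.real (Iic t) * F.real (Iic t)ᶜ ≤ M * |t| ^ (-α) := by
  refine le_trans ?_ (real_abs_ge_le_mul_rpow_neg hα hF (abs_pos.2 ht))
  rcases ht.lt_or_gt with h | h
  · refine (mul_le_of_le_one_right measureReal_nonneg measureReal_le_one).trans
      (measureReal_mono fun x (hx : x ≤ t) => ?_)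
    rw [mem_ofPred_eq, abs_of_neg h, abs_of_neg (hx.trans_lt h)]
    exact neg_le_neg hx
  · refine (mul_le_of_le_one_left measureReal_nonneg measureReal_le_one).trans
      (measureReal_mono fun x hx => ?_)
    have hxt : t < x := by simpa using hx
    rw [mem_ofPred_eq, abs_of_pos h, abs_of_pos (h.trans hxt)]
    exact hxt.le

end Tail

section PowerIntegrals

lemma lintegral_eq_setLIntegral_Ioi_add_neg (f : ℝ → ℝ≥0∞) :
    ∫⁻ t, f t = (∫⁻ t in Ioi 0, f t) + ∫⁻ t in Ioi 0, f (-t) := by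
  have hneg : ∫⁻ t in Iio 0, f t = ∫⁻ t in Ioi 0, f (-t) := by
    rw [← lintegral_indicator measurableSet_Iio, ← lintegral_indicator measurableSet_Ioi,
      ← lintegral_neg_eq_self]
    refine lintegral_congr fun t => ?_
    by_cases h : 0 < t <;> simp [h]
  rw [← hneg, ← setLIntegral_congr Iio_ae_eq_Iic.symm, ← compl_Ioi,
    lintegral_add_compl _ measurableSet_Ioi]

lemma setLIntegral_Ioc_rpow {T s : ℝ} (hT : 0 ≤ T) (hs : -1 < s) :
    ∫⁻ t in Ioc 0 T, ENNReal.ofReal (t ^ s) = ENNReal.ofReal (T ^ (s + 1) / (s + 1)) := by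
  have hint : IntegrableOn (fun t : ℝ => t ^ s) (Ioc 0 T) :=
    (intervalIntegrable_iff_integrableOn_Ioc_of_le hT).1
      (intervalIntegral.intervalIntegrable_rpow' hs)
  rw [← ofReal_integral_eq_lintegral_ofReal hint, ← intervalIntegral.integral_of_le hT,
    integral_rpow (Or.inl hs), Real.zero_rpow (by linarith), sub_zero]
  filter_upwards [ae_restrict_mem measurableSet_Ioc] with t ht
  exact Real.rpow_nonneg ht.1.le _

lemma setLIntegral_Ioi_rpow {T s : ℝ} (hT : 0 < T) (hs : s < -1) :
    ∫⁻ t in Ioi T, ENNReal.ofReal (t ^ s) = ENNReal.ofReal (-T ^ (s + 1) / (s + 1)) := by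
  rw [← ofReal_integral_eq_lintegral_ofReal (integrableOn_Ioi_rpow_of_lt hs hT),
    integral_Ioi_rpow_of_lt hs hT]
  filter_upwards [ae_restrict_mem measurableSet_Ioi] with t ht
  exact Real.rpow_nonneg (hT.trans ht).le _

variable {a b r s T : ℝ}

lemma setLIntegral_Ioi_le_of_le_rpow {f : ℝ → ℝ≥0∞} (ha : 0 ≤ a) (hb : 0 ≤ b) (hs : s < 1)
    (hr : 1 < r) (hT : 0 < T) (hsmall : ∀ t, 0 < t → f t ≤ ENNReal.ofReal (a * t ^ (-s)))
    (hlarge : ∀ t, 0 < t → f t ≤ ENNReal.ofReal (b * t ^ (-r))) :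
    ∫⁻ t in Ioi 0, f t ≤
      ENNReal.ofReal (a * (T ^ (1 - s) / (1 - s)) + b * (T ^ (1 - r) / (r - 1))) := by
  rw [← Ioc_union_Ioi_eq_Ioi hT.le,
    ENNReal.ofReal_add (by positivity [sub_pos.2 hs]) (by positivity [sub_pos.2 hr])]
  refine (lintegral_union_le _ _ _).trans (add_le_add ?_ ?_)
  · calc ∫⁻ t in Ioc 0 T, f t
        ≤ ∫⁻ t in Ioc 0 T, ENNReal.ofReal a * ENNReal.ofReal (t ^ (-s)) :=
          setLIntegral_mono' measurableSet_Ioc fun t ht =>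
            (hsmall t ht.1).trans_eq (ENNReal.ofReal_mul ha)
      _ = ENNReal.ofReal (a * (T ^ (1 - s) / (1 - s))) := by
          rw [lintegral_const_mul _ (by fun_prop), setLIntegral_Ioc_rpow hT.le (by linarith),
            ← ENNReal.ofReal_mul ha, neg_add_eq_sub]
  · calc ∫⁻ t in Ioi T, f t
        ≤ ∫⁻ t in Ioi T, ENNReal.ofReal b * ENNReal.ofReal (t ^ (-r)) :=
          setLIntegral_mono' measurableSet_Ioi fun t ht =>
            (hlarge t (hT.trans ht)).trans_eq (ENNReal.ofReal_mul hb)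
      _ = ENNReal.ofReal (b * (T ^ (1 - r) / (r - 1))) := by
          rw [lintegral_const_mul _ (by fun_prop), setLIntegral_Ioi_rpow hT (by linarith),
            ← ENNReal.ofReal_mul hb, neg_add_eq_sub, neg_div, ← div_neg, neg_sub]

lemma lintegral_le_of_le_abs_rpow {f : ℝ → ℝ≥0∞} (ha : 0 ≤ a) (hb : 0 ≤ b) (hs : s < 1)
    (hr : 1 < r) (hT : 0 < T) (hsmall : ∀ t ≠ 0, f t ≤ ENNReal.ofReal (a * |t| ^ (-s)))
    (hlarge : ∀ t ≠ 0, f t ≤ ENNReal.ofReal (b * |t| ^ (-r))) :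
    ∫⁻ t, f t ≤
      ENNReal.ofReal (2 * (a * (T ^ (1 - s) / (1 - s)) + b * (T ^ (1 - r) / (r - 1)))) := by
  rw [lintegral_eq_setLIntegral_Ioi_add_neg, ENNReal.ofReal_mul zero_le_two,
    ENNReal.ofReal_ofNat, two_mul]
  refine add_le_add
    (setLIntegral_Ioi_le_of_le_rpow ha hb hs hr hT (fun t ht => ?_) fun t ht => ?_)
    (setLIntegral_Ioi_le_of_le_rpow ha hb hs hr hT (fun t ht => ?_) fun t ht => ?_)
  · simpa only [abs_of_pos ht] using hsmall t ht.ne'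
  · simpa only [abs_of_pos ht] using hlarge t ht.ne'
  · simpa only [abs_neg, abs_of_pos ht] using hsmall (-t) (neg_ne_zero.2 ht.ne')
  · simpa only [abs_neg, abs_of_pos ht] using hlarge (-t) (neg_ne_zero.2 ht.ne')

end PowerIntegrals

/-- The constant in the rate of convergence `m ^ (-1 + 1 / α)` of the empirical measures of a
law whose absolute moment of order `α` is at most `M`. -/
def rateConst (α M : ℝ) : ℝ := 2 * (√M / (1 - α / 2) + 2 * M / (α - 1))

lemma rateConst_nonneg {α M : ℝ} (hα1 : 1 < α) (hα2 : α < 2) (hM : 0 ≤ M) :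
    0 ≤ rateConst α M := by
  have hα2' : 0 < 1 - α / 2 := by linarith
  rw [rateConst]
  positivity [hα2', sub_pos.2 hα1]

lemma rateConst_mul_rpow {α M m : ℝ} (hα : α ≠ 0) (hm : 0 < m) (hM : 0 ≤ M) :
    2 * (√(M / m) * ((m ^ (1 / α)) ^ (1 - α / 2) / (1 - α / 2)) +
      2 * M * ((m ^ (1 / α)) ^ (1 - α) / (α - 1))) = rateConst α M * m ^ (-1 + 1 / α) := by
  have hsmall : √(M / m) * (m ^ (1 / α)) ^ (1 - α / 2) = √M * m ^ (-1 + 1 / α) := by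
    rw [Real.sqrt_div hM, Real.sqrt_eq_rpow m, ← Real.rpow_mul hm.le, div_mul_eq_mul_div,
      mul_div_assoc, ← Real.rpow_sub hm]
    congr 2
    field_simp
    ring
  have hlarge : (m ^ (1 / α)) ^ (1 - α) = m ^ (-1 + 1 / α) := by
    rw [← Real.rpow_mul hm.le]
    congr 1
    field_simp
    ring
  rw [← mul_div_assoc, hsmall, hlarge, rateConst]
  ring

lemma lintegral_cdfDist_empirical_le {m : ℕ} [NeZero m] (F : Measure ℝ) [IsProbabilityMeasure F]
    {α : ℝ} {M : ℝ≥0} (hα1 : 1 < α) (hα2 : α < 2) (hF : ∫⁻ x, ‖x‖ₑ ^ α ∂F ≤ M) :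
    ∫⁻ y, cdfDist (empirical y) F ∂(Measure.pi fun _ : Fin m => F) ≤
      ENNReal.ofReal (rateConst α M * (m : ℝ) ^ (-1 + 1 / α)) := by
  have hm : (0 : ℝ) < m := by exact_mod_cast NeZero.pos m
  have hvar (t : ℝ) (ht : t ≠ 0) := real_Iic_mul_compl_le (by linarith) hF ht
  simp only [cdfDist]
  rw [lintegral_lintegral_swap (measurable_empirical_real_Iic_sub F).enorm.aemeasurable,
    ← rateConst_mul_rpow (zero_lt_one.trans hα1).ne' hm M.coe_nonneg]
  -- For small `t` the variance bound is better, for large `t` the first moment bound; they cross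
  -- at `|t| = m ^ (1 / α)`.
  refine lintegral_le_of_le_abs_rpow (by positivity) (by positivity) (by linarith) hα1
    (Real.rpow_pos_of_pos hm _) (fun t ht => ?_) fun t ht => ?_
  · refine (lintegral_enorm_empirical_sub_le_sqrt F measurableSet_Iic).trans
      (ENNReal.ofReal_le_ofReal ?_)
    calc √(F.real (Iic t) * F.real (Iic t)ᶜ / m) ≤ √(M * |t| ^ (-α) / m) :=
          Real.sqrt_le_sqrt (div_le_div_of_nonneg_right (hvar t ht) hm.le)
      _ = √(M / m) * |t| ^ (-(α / 2)) := by
          rw [mul_div_right_comm, Real.sqrt_mul (by positivity), Real.sqrt_eq_rpow (|t| ^ (-α)),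
            ← Real.rpow_mul (abs_nonneg t)]
          ring_nf
  · refine (lintegral_enorm_empirical_sub_le F measurableSet_Iic).trans
      (ENNReal.ofReal_le_ofReal ?_)
    rw [mul_assoc]
    exact mul_le_mul_of_nonneg_left (hvar t ht) zero_le_two

end EmpiricalRate

section OneLevel

variable {μ : Measure BranchVec} {Y : Type*} [MeasurableSpace Y]

/-- The quantity `ρ_γ` as an extended nonnegative real, so that it is infinite, and not `0`, when
the expectation diverges. -/
def lrho (μ : Measure BranchVec) (γ : ℝ) : ℝ≥0∞ :=
  ∫⁻ v, ∑ i ∈ Finset.range (BranchVec.N v), ‖BranchVec.C v i‖ₑ ^ γ ∂μ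

lemma lintegral_eval_infinitePi (ν : Measure Y) [IsProbabilityMeasure ν] {f : Y → ℝ≥0∞}
    (hf : Measurable f) (r : ℕ) :
    ∫⁻ w, f (w r) ∂(Measure.infinitePi fun _ : ℕ => ν) = ∫⁻ y, f y ∂ν :=
  (measurePreserving_eval_infinitePi (fun _ : ℕ => ν) r).lintegral_comp hf

lemma lintegral_sum_mul_eval_infinitePi (ν : Measure Y) [IsProbabilityMeasure ν] {f : Y → ℝ≥0∞}
    (hf : Measurable f) (s : Finset ℕ) (c : ℕ → ℝ≥0∞) :
    ∫⁻ w, ∑ r ∈ s, c r * f (w r) ∂(Measure.infinitePi fun _ : ℕ => ν) =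
      (∑ r ∈ s, c r) * ∫⁻ y, f y ∂ν := by
  rw [lintegral_finsetSum _ fun r _ => by fun_prop, Finset.sum_mul]
  refine Finset.sum_congr rfl fun r _ => ?_
  rw [lintegral_const_mul _ (by fun_prop), lintegral_eval_infinitePi ν hf]

lemma lintegral_lintegral_sum_C_mul_eval (μ : Measure BranchVec) (ν : Measure Y)
    [IsProbabilityMeasure ν] {f : Y → ℝ≥0∞} (hf : Measurable f) :
    ∫⁻ v, ∫⁻ w, ∑ r ∈ Finset.range (BranchVec.N v), ‖BranchVec.C v r‖ₑ * f (w r)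
      ∂(Measure.infinitePi fun _ : ℕ => ν) ∂μ = lrho μ 1 * ∫⁻ y, f y ∂ν := by
  simp only [lintegral_sum_mul_eval_infinitePi ν hf, lrho, ENNReal.rpow_one]
  exact lintegral_mul_const _ (measurable_sum_range measurable_N fun i => by fun_prop)

lemma enorm_step_sub_step_le (v : BranchVec) (x y : ℕ → ℝ) :
    ‖step v x - step v y‖ₑ ≤
      ∑ r ∈ Finset.range (BranchVec.N v), ‖BranchVec.C v r‖ₑ * ‖x r - y r‖ₑ := by
  simp only [step, add_sub_add_right_eq_sub, ← Finset.sum_sub_distrib, ← mul_sub, ← enorm_mul]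
  exact enorm_sum_le _ _

lemma measurable_step_comp {f : Y → ℝ} (hf : Measurable f) :
    Measurable fun s : BranchVec × (ℕ → Y) => step s.1 fun r => f (s.2 r) :=
  measurable_step.comp (f := fun s : BranchVec × (ℕ → Y) => (s.1, fun r => f (s.2 r)))
    (measurable_fst.prodMk (by fun_prop))

lemma lintegral_enorm_step_sub_step_le (ν : Measure Y) [IsProbabilityMeasure ν] {f g : Y → ℝ}
    (hf : Measurable f) (hg : Measurable g) :
    ∫⁻ s, ‖(step s.1 fun r => f (s.2 r)) - step s.1 fun r => g (s.2 r)‖ₑ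
        ∂(μ.prod (Measure.infinitePi fun _ : ℕ => ν)) ≤ lrho μ 1 * ∫⁻ y, ‖f y - g y‖ₑ ∂ν := by
  have hfm := measurable_step_comp hf
  have hgm := measurable_step_comp hg
  rw [lintegral_prod _ (by fun_prop), ← lintegral_lintegral_sum_C_mul_eval μ ν (by fun_prop)]
  exact lintegral_mono fun v => lintegral_mono fun w => enorm_step_sub_step_le v _ _

variable [IsProbabilityMeasure μ]

lemma map_step_comp (ν : Measure Y) [IsProbabilityMeasure ν] {f : Y → ℝ} (hf : Measurable f) :
    (μ.prod (Measure.infinitePi fun _ : ℕ => ν)).map (fun s => step s.1 fun r => f (s.2 r)) =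
      smoothing μ (ν.map f) := by
  have hseq : Measurable fun (w : ℕ → Y) (r : ℕ) => f (w r) := by fun_prop
  have hprod : μ.prod (Measure.infinitePi fun _ : ℕ => ν.map f) =
      (μ.prod (Measure.infinitePi fun _ : ℕ => ν)).map
        (Prod.map id fun (w : ℕ → Y) (r : ℕ) => f (w r)) := by
    rw [← Measure.map_prod_map _ _ measurable_id hseq, Measure.map_id,
      Measure.infinitePi_map_pi _ fun _ => hf]
  rw [smoothing, hprod, Measure.map_map measurable_step (measurable_id.prodMap hseq)]
  rfl

variable {m : ℕ}

lemma pi_map_const {σ : Measure Y} [IsProbabilityMeasure σ] {a : Y → ℝ} (ha : Measurable a) :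
    (Measure.pi fun _ : Fin m => σ.map a) =
      (Measure.pi fun _ : Fin m => σ).map fun s i => a (s i) := by
  have := Measure.isProbabilityMeasure_map (μ := σ) ha.aemeasurable
  exact (Measure.pi_map_pi fun _ => ha.aemeasurable).symm

variable [NeZero m]

lemma lintegral_inv_mul_sum_eval_pi (σ : Measure Y) [IsProbabilityMeasure σ] {f : Y → ℝ≥0∞}
    (hf : Measurable f) :
    ∫⁻ s, (m : ℝ≥0∞)⁻¹ * ∑ i, f (s i) ∂(Measure.pi fun _ : Fin m => σ) = ∫⁻ y, f y ∂σ := by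
  have heval (i : Fin m) : ∫⁻ s, f (s i) ∂(Measure.pi fun _ : Fin m => σ) = ∫⁻ y, f y ∂σ :=
    (measurePreserving_eval (fun _ : Fin m => σ) i).lintegral_comp hf
  rw [lintegral_const_mul _ (by fun_prop), lintegral_finsetSum _ fun i _ => by fun_prop]
  simp only [heval, Finset.sum_const, Finset.card_univ, Fintype.card_fin, nsmul_eq_mul]
  rw [← mul_assoc, ENNReal.inv_mul_cancel (by simp [NeZero.ne m]) (ENNReal.natCast_ne_top m),
    one_mul]

lemma lintegral_cdfDist_empirical_map_le (σ : Measure Y) [IsProbabilityMeasure σ] (G : Measure ℝ)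
    [IsFiniteMeasure G] {a b : Y → ℝ} (ha : Measurable a) (hb : Measurable b) :
    ∫⁻ y, cdfDist (empirical y) G ∂(Measure.pi fun _ : Fin m => σ.map a) ≤
      ∫⁻ s, ‖a s - b s‖ₑ ∂σ +
        ∫⁻ y, cdfDist (empirical y) G ∂(Measure.pi fun _ : Fin m => σ.map b) := by
  have hG := measurable_cdfDist_empirical (m := m) G
  rw [pi_map_const ha, pi_map_const hb, lintegral_map hG (by fun_prop),
    lintegral_map hG (by fun_prop), ← lintegral_inv_mul_sum_eval_pi (m := m) σ (by fun_prop),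
    ← lintegral_add_left (by fun_prop)]
  exact lintegral_mono fun s => (cdfDist_triangle _ (empirical fun i => b (s i)) _).trans
    (add_le_add_left (cdfDist_empirical_le _ _) _)

lemma lintegral_cdfDist_smoothing_le (ν F : Measure ℝ) [IsProbabilityMeasure ν]
    [IsProbabilityMeasure F] :
    ∫⁻ y, cdfDist (empirical y) (smoothing μ F) ∂(Measure.pi fun _ : Fin m => smoothing μ ν) ≤
      lrho μ 1 * cdfDist ν F +
        ∫⁻ y, cdfDist (empirical y) (smoothing μ F)
          ∂(Measure.pi fun _ : Fin m => smoothing μ F) := by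
  obtain ⟨_, hfst, hsnd⟩ := quantileCoupling_mem_couplings ν F
  have hν := map_step_comp (μ := μ) (quantileCoupling ν F) measurable_fst
  have hF := map_step_comp (μ := μ) (quantileCoupling ν F) measurable_snd
  rw [hfst] at hν
  rw [hsnd] at hF
  calc ∫⁻ y, cdfDist (empirical y) (smoothing μ F) ∂(Measure.pi fun _ : Fin m => smoothing μ ν)
      ≤ _ := hν ▸ lintegral_cdfDist_empirical_map_le _ (smoothing μ F)
          (measurable_step_comp measurable_fst) (measurable_step_comp measurable_snd)
    _ ≤ _ := by
        rw [hF]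
        gcongr
        exact (lintegral_enorm_step_sub_step_le _ measurable_fst measurable_snd).trans
          (mul_le_mul_right (lintegral_enorm_quantileCoupling_le ν F) _)

end OneLevel

section Rho

lemma sum_rpow_le_rpow_sum {ι : Type*} (s : Finset ι) {c : ι → ℝ} (hc : ∀ i, 0 ≤ c i) {γ : ℝ}
    (hγ : 1 ≤ γ) : ∑ i ∈ s, c i ^ γ ≤ (∑ i ∈ s, c i) ^ γ := by
  induction s using Finset.cons_induction with
  | empty => simp only [Finset.sum_empty]; exact Real.rpow_nonneg le_rfl γ
  | cons i s hi ih =>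
    rw [Finset.sum_cons, Finset.sum_cons]
    exact (add_le_add_right ih _).trans
      (Real.add_rpow_le_rpow_add (hc i) (Finset.sum_nonneg fun j _ => hc j) hγ)

lemma convexOn_rpow_exponent {c : ℝ} (hc : 0 ≤ c) : ConvexOn ℝ (Ioi 0) fun γ : ℝ => c ^ γ := by
  rcases hc.eq_or_lt with rfl | hc
  · exact (convexOn_const 0 (convex_Ioi 0)).congr fun γ hγ => (Real.zero_rpow (ne_of_gt hγ)).symm
  · exact (convexOn_rpow_left hc).subset (subset_univ _) (convex_Ioi 0)

lemma measurable_sum_abs_C :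
    Measurable fun v => ∑ i ∈ Finset.range (BranchVec.N v), |BranchVec.C v i| :=
  measurable_sum_range measurable_N fun i => by fun_prop

lemma sum_abs_C_rpow_nonneg (v : BranchVec) (γ : ℝ) :
    0 ≤ ∑ i ∈ Finset.range (BranchVec.N v), |BranchVec.C v i| ^ γ :=
  Finset.sum_nonneg fun _ _ => Real.rpow_nonneg (abs_nonneg _) _

lemma enorm_sum_abs_C (v : BranchVec) :
    ‖∑ i ∈ Finset.range (BranchVec.N v), |BranchVec.C v i|‖ₑ =
      ∑ i ∈ Finset.range (BranchVec.N v), ‖BranchVec.C v i‖ₑ := by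
  rw [Real.enorm_of_nonneg (Finset.sum_nonneg fun _ _ => abs_nonneg _),
    ENNReal.ofReal_sum_of_nonneg fun _ _ => abs_nonneg _]
  simp only [Real.enorm_eq_ofReal_abs]

variable {μ : Measure BranchVec} {β γ : ℝ}

lemma lrho_eq_ofReal_rho (hγ : 0 ≤ γ) (h : Integrable
    (fun v => ∑ i ∈ Finset.range (BranchVec.N v), |BranchVec.C v i| ^ γ) μ) :
    lrho μ γ = ENNReal.ofReal (rho μ γ) := by
  rw [rho, ofReal_integral_eq_lintegral_ofReal h (ae_of_all _ fun v => sum_abs_C_rpow_nonneg v γ)]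
  refine lintegral_congr fun v => ?_
  rw [ENNReal.ofReal_sum_of_nonneg fun _ _ => Real.rpow_nonneg (abs_nonneg _) _]
  simp only [Real.enorm_eq_ofReal_abs, ENNReal.ofReal_rpow_of_nonneg (abs_nonneg _) hγ]

lemma rho_nonneg : 0 ≤ rho μ γ :=
  integral_nonneg fun v => sum_abs_C_rpow_nonneg v γ

variable [IsFiniteMeasure μ]

lemma integrable_sum_abs_C_rpow (h : Integrable
    (fun v => (∑ i ∈ Finset.range (BranchVec.N v), |BranchVec.C v i|) ^ β) μ)
    (hγ : γ ∈ Icc 1 β) :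
    Integrable (fun v => ∑ i ∈ Finset.range (BranchVec.N v), |BranchVec.C v i| ^ γ) μ := by
  have hγ0 : 0 ≤ γ := zero_le_one.trans hγ.1
  have hnorm (v : BranchVec) : ‖∑ i ∈ Finset.range (BranchVec.N v), |BranchVec.C v i|‖ =
      ∑ i ∈ Finset.range (BranchVec.N v), |BranchVec.C v i| :=
    Real.norm_of_nonneg (Finset.sum_nonneg fun _ _ => abs_nonneg _)
  have hint := integrable_norm_rpow_of_le (p := γ) measurable_sum_abs_C.aestronglyMeasurable hγ0
    (hγ0.trans hγ.2) hγ.2 (by simpa only [hnorm] using h)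
  refine hint.mono' (measurable_sum_range measurable_N fun i => by
    fun_prop).aestronglyMeasurable (ae_of_all _ fun v => ?_)
  rw [Real.norm_of_nonneg (sum_abs_C_rpow_nonneg v γ), hnorm]
  exact sum_rpow_le_rpow_sum _ (fun _ => abs_nonneg _) hγ.1

lemma convexOn_rho (h : Integrable
    (fun v => (∑ i ∈ Finset.range (BranchVec.N v), |BranchVec.C v i|) ^ β) μ) :
    ConvexOn ℝ (Icc 1 β) (rho μ) := by
  refine ⟨convex_Icc 1 β, fun x hx y hy a b ha hb hab => ?_⟩
  have hpos {z : ℝ} (hz : z ∈ Icc 1 β) : z ∈ Ioi (0 : ℝ) := zero_lt_one.trans_le hz.1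
  have hxi := (integrable_sum_abs_C_rpow h hx).const_mul a
  have hyi := (integrable_sum_abs_C_rpow h hy).const_mul b
  simp only [rho, smul_eq_mul]
  rw [← integral_const_mul, ← integral_const_mul, ← integral_add hxi hyi]
  refine integral_mono (integrable_sum_abs_C_rpow h (convex_Icc 1 β hx hy ha hb hab))
    (hxi.add hyi) fun v => ?_
  simp only [Finset.mul_sum, ← Finset.sum_add_distrib]
  exact Finset.sum_le_sum fun i _ =>
    (convexOn_rpow_exponent (abs_nonneg _)).2 (hpos hx) (hpos hy) ha hb hab

lemma rho_le_max (h : Integrable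
    (fun v => (∑ i ∈ Finset.range (BranchVec.N v), |BranchVec.C v i|) ^ β) μ)
    (hγ : γ ∈ Icc 1 β) : rho μ γ ≤ max (rho μ 1) (rho μ β) :=
  (convexOn_rho h).le_max_of_mem_Icc (left_mem_Icc.2 (hγ.1.trans hγ.2))
    (right_mem_Icc.2 (hγ.1.trans hγ.2)) hγ

end Rho

section PowerOfSum

variable {Ω : Type*} [MeasurableSpace Ω] {P : Measure Ω}

lemma lintegral_rpow_le_rpow_lintegral [IsProbabilityMeasure P] {g : Ω → ℝ≥0∞} (hg : Measurable g)
    {a : ℝ} (ha0 : 0 < a) (ha1 : a ≤ 1) : ∫⁻ x, g x ^ a ∂P ≤ (∫⁻ x, g x ∂P) ^ a := by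
  have h := eLpNorm'_le_eLpNorm'_of_exponent_le (f := g) ha0 ha1 P hg.aestronglyMeasurable
  simp only [eLpNorm', enorm_eq_self, ENNReal.rpow_one, div_one] at h
  rwa [one_div, ENNReal.rpow_inv_le_iff ha0] at h

lemma lintegral_rpow_le_one_add [IsProbabilityMeasure P] (f : Ω → ℝ≥0∞) {γ β : ℝ} (hγ : 0 ≤ γ)
    (hγβ : γ ≤ β) : ∫⁻ x, f x ^ γ ∂P ≤ 1 + ∫⁻ x, f x ^ β ∂P := by
  have hpt (x : ℝ≥0∞) : x ^ γ ≤ 1 + x ^ β := by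
    rcases le_total x 1 with h | h
    · exact (ENNReal.rpow_le_one h hγ).trans le_self_add
    · exact (ENNReal.rpow_le_rpow_of_exponent_le h hγβ).trans le_add_self
  calc ∫⁻ x, f x ^ γ ∂P ≤ ∫⁻ x, (1 + f x ^ β) ∂P := lintegral_mono fun x => hpt (f x)
    _ = 1 + ∫⁻ x, f x ^ β ∂P := by rw [lintegral_add_left measurable_const]; simp

lemma rpow_one_add (x : ℝ≥0∞) {a : ℝ} (ha : 0 ≤ a) : x ^ (1 + a) = x * x ^ a := by
  rw [ENNReal.rpow_add_of_nonneg _ _ zero_le_one ha, ENNReal.rpow_one]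

lemma add_sum_rpow_le {ι : Type*} [DecidableEq ι] (q : ℝ≥0∞) (s : Finset ι) (y : ι → ℝ≥0∞) {a : ℝ}
    (ha0 : 0 ≤ a) (ha1 : a ≤ 1) :
    (q + ∑ i ∈ s, y i) ^ (1 + a) ≤ q * (q + ∑ i ∈ s, y i) ^ a +
      ∑ i ∈ s, (y i ^ (1 + a) + y i * (q + ∑ j ∈ s.erase i, y j) ^ a) := by
  rw [rpow_one_add _ ha0, add_mul, Finset.sum_mul]
  gcongr with i hi
  rw [rpow_one_add _ ha0, ← mul_add, ← Finset.add_sum_erase _ _ hi, add_left_comm]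
  gcongr
  exact ENNReal.rpow_add_le_add_rpow _ _ ha0 ha1

variable {ι : Type*} {Y : ι → Ω → ℝ≥0∞}

lemma lintegral_mul_add_sum_rpow_of_notMem (hYm : ∀ i, Measurable (Y i)) (hY : iIndepFun Y P)
    (q : ℝ≥0∞) (a : ℝ) {i : ι} {s : Finset ι} (hi : i ∉ s) :
    ∫⁻ ω, Y i ω * (q + ∑ j ∈ s, Y j ω) ^ a ∂P =
      (∫⁻ ω, Y i ω ∂P) * ∫⁻ ω, (q + ∑ j ∈ s, Y j ω) ^ a ∂P := by
  have hind := (hY.indepFun_finsetSum_of_notMem hYm hi).symm.comp measurable_id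
    (show Measurable fun z : ℝ≥0∞ => (q + z) ^ a by fun_prop)
  refine lintegral_mul_eq_lintegral_mul_lintegral_of_indepFun (hYm i) (by fun_prop) ?_
  simpa only [Function.comp_def, Finset.sum_apply, id] using hind

lemma lintegral_add_sum_rpow_le_rpow [IsProbabilityMeasure P] (hYm : ∀ i, Measurable (Y i))
    (q : ℝ≥0∞) (s : Finset ι) {a : ℝ} (ha0 : 0 < a) (ha1 : a ≤ 1) :
    ∫⁻ ω, (q + ∑ i ∈ s, Y i ω) ^ a ∂P ≤ (q + ∑ i ∈ s, ∫⁻ ω, Y i ω ∂P) ^ a := by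
  refine (lintegral_rpow_le_rpow_lintegral (by fun_prop) ha0 ha1).trans_eq ?_
  rw [lintegral_add_left measurable_const, lintegral_finsetSum _ fun i _ => hYm i]
  simp

-- The bound is additive in the moments of order `1 + a`: this is what makes the `α`th moment
-- of a sum of independent terms contract with the factor `ρ_α`.
lemma lintegral_add_sum_rpow_le [IsProbabilityMeasure P] (hYm : ∀ i, Measurable (Y i))
    (hY : iIndepFun Y P) (q : ℝ≥0∞) (s : Finset ι) {a : ℝ} (ha0 : 0 < a) (ha1 : a ≤ 1) :
    ∫⁻ ω, (q + ∑ i ∈ s, Y i ω) ^ (1 + a) ∂P ≤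
      ∑ i ∈ s, ∫⁻ ω, Y i ω ^ (1 + a) ∂P + (q + ∑ i ∈ s, ∫⁻ ω, Y i ω ∂P) ^ (1 + a) := by
  classical
  set E := (q + ∑ i ∈ s, ∫⁻ ω, Y i ω ∂P) ^ a
  have herase (i : ι) : ∫⁻ ω, (q + ∑ j ∈ s.erase i, Y j ω) ^ a ∂P ≤ E :=
    (lintegral_add_sum_rpow_le_rpow hYm q _ ha0 ha1).trans <| ENNReal.rpow_le_rpow
      (add_le_add_right (Finset.sum_le_sum_of_subset (Finset.erase_subset i s)) q) ha0.le
  calc ∫⁻ ω, (q + ∑ i ∈ s, Y i ω) ^ (1 + a) ∂P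
      ≤ ∫⁻ ω, (q * (q + ∑ i ∈ s, Y i ω) ^ a +
          ∑ i ∈ s, (Y i ω ^ (1 + a) + Y i ω * (q + ∑ j ∈ s.erase i, Y j ω) ^ a)) ∂P :=
        lintegral_mono fun ω => add_sum_rpow_le q s (fun i => Y i ω) ha0.le ha1
    _ = q * ∫⁻ ω, (q + ∑ i ∈ s, Y i ω) ^ a ∂P + ∑ i ∈ s, (∫⁻ ω, Y i ω ^ (1 + a) ∂P +
          (∫⁻ ω, Y i ω ∂P) * ∫⁻ ω, (q + ∑ j ∈ s.erase i, Y j ω) ^ a ∂P) := by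
        rw [lintegral_add_left (by fun_prop), lintegral_const_mul _ (by fun_prop),
          lintegral_finsetSum _ fun i _ => by fun_prop]
        congr! with i
        rw [lintegral_add_left (by fun_prop),
          lintegral_mul_add_sum_rpow_of_notMem hYm hY q a (Finset.notMem_erase i s)]
    _ ≤ q * E + ∑ i ∈ s, (∫⁻ ω, Y i ω ^ (1 + a) ∂P + (∫⁻ ω, Y i ω ∂P) * E) := by
        gcongr with i
        · exact lintegral_add_sum_rpow_le_rpow hYm q s ha0 ha1
        · exact herase i
    _ = _ := by
        rw [Finset.sum_add_distrib, ← Finset.sum_mul, rpow_one_add _ ha0.le]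
        ring

end PowerOfSum

section MomentsOfSmoothing

variable {μ : Measure BranchVec} {α : ℝ} {ν : Measure ℝ} [IsProbabilityMeasure ν]

lemma lintegral_smoothing {f : ℝ → ℝ≥0∞} (hf : Measurable f) :
    ∫⁻ x, f x ∂(smoothing μ ν) =
      ∫⁻ v, ∫⁻ w, f (step v w) ∂(Measure.infinitePi fun _ : ℕ => ν) ∂μ := by
  rw [smoothing, lintegral_map hf measurable_step,
    lintegral_prod _ (by exact (hf.comp measurable_step).aemeasurable)]

lemma lintegral_lawR_zero {f : ℝ → ℝ≥0∞} (hf : Measurable f) :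
    ∫⁻ x, f x ∂(lawR μ 0) = ∫⁻ v, f (BranchVec.Q v) ∂μ :=
  lintegral_map hf measurable_Q

lemma enorm_step_le (v : BranchVec) (x : ℕ → ℝ) :
    ‖step v x‖ₑ ≤ ‖BranchVec.Q v‖ₑ +
      ∑ r ∈ Finset.range (BranchVec.N v), ‖BranchVec.C v r‖ₑ * ‖x r‖ₑ := by
  simp only [step, ← enorm_mul, add_comm _ (BranchVec.Q v)]
  exact (enorm_add_le _ _).trans (add_le_add_right (enorm_sum_le _ _) _)

lemma lintegral_enorm_smoothing_le :
    ∫⁻ x, ‖x‖ₑ ∂(smoothing μ ν) ≤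
      lrho μ 1 * ∫⁻ x, ‖x‖ₑ ∂ν + ∫⁻ v, ‖BranchVec.Q v‖ₑ ∂μ := by
  rw [lintegral_smoothing measurable_enorm, ← lintegral_lintegral_sum_C_mul_eval μ ν
    measurable_enorm, add_comm, ← lintegral_add_left (by fun_prop)]
  refine lintegral_mono fun v => (lintegral_mono (enorm_step_le v)).trans_eq ?_
  rw [lintegral_add_left measurable_const, lintegral_const, measure_univ, mul_one]

lemma lintegral_enorm_step_rpow_le (v : BranchVec) (hα1 : 1 < α) (hα2 : α ≤ 2) :
    ∫⁻ w, ‖step v w‖ₑ ^ α ∂(Measure.infinitePi fun _ : ℕ => ν) ≤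
      (∑ i ∈ Finset.range (BranchVec.N v), ‖BranchVec.C v i‖ₑ ^ α) * ∫⁻ x, ‖x‖ₑ ^ α ∂ν +
        (‖BranchVec.Q v‖ₑ + (∑ i ∈ Finset.range (BranchVec.N v), ‖BranchVec.C v i‖ₑ) *
          ∫⁻ x, ‖x‖ₑ ∂ν) ^ α := by
  have hα0 : 0 ≤ α := by linarith
  have hind : iIndepFun (fun r (w : ℕ → ℝ) => ‖BranchVec.C v r‖ₑ * ‖w r‖ₑ)
      (Measure.infinitePi fun _ : ℕ => ν) :=
    iIndepFun_infinitePi (X := fun r x => ‖BranchVec.C v r‖ₑ * ‖x‖ₑ) fun r => by fun_prop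
  have h := lintegral_add_sum_rpow_le (fun r => by fun_prop) hind ‖BranchVec.Q v‖ₑ
    (Finset.range (BranchVec.N v)) (sub_pos.2 hα1) (by linarith : α - 1 ≤ 1)
  simp only [add_sub_cancel, ENNReal.mul_rpow_of_nonneg _ _ hα0] at h
  rw [← lintegral_finsetSum _ fun r _ => by fun_prop,
    ← lintegral_finsetSum _ fun r _ => by fun_prop,
    lintegral_sum_mul_eval_infinitePi ν (f := fun x => ‖x‖ₑ ^ α) (by fun_prop),
    lintegral_sum_mul_eval_infinitePi ν measurable_enorm] at h
  exact (lintegral_mono fun w => ENNReal.rpow_le_rpow (enorm_step_le v w) hα0).trans h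

lemma lintegral_enorm_rpow_smoothing_le (hα1 : 1 < α) (hα2 : α ≤ 2) :
    ∫⁻ x, ‖x‖ₑ ^ α ∂(smoothing μ ν) ≤ lrho μ α * ∫⁻ x, ‖x‖ₑ ^ α ∂ν +
      ∫⁻ v, (‖BranchVec.Q v‖ₑ + (∑ i ∈ Finset.range (BranchVec.N v), ‖BranchVec.C v i‖ₑ) *
        ∫⁻ x, ‖x‖ₑ ∂ν) ^ α ∂μ := by
  have hm : Measurable fun v =>
      ∑ i ∈ Finset.range (BranchVec.N v), ‖BranchVec.C v i‖ₑ ^ α :=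
    measurable_sum_range measurable_N fun i => by fun_prop
  rw [lintegral_smoothing (by fun_prop), lrho, ← lintegral_mul_const _ hm,
    ← lintegral_add_left (by fun_prop)]
  exact lintegral_mono fun v => lintegral_enorm_step_rpow_le v hα1 hα2

end MomentsOfSmoothing

lemma exists_forall_le_of_affine_recursion {u : ℕ → ℝ≥0∞} {r b : ℝ≥0∞} (hr : r < 1)
    (hb : b ≠ ⊤) (h0 : u 0 ≤ b) (hu : ∀ k, u (k + 1) ≤ r * u k + b) :
    ∃ M : NNReal, ∀ k, u k ≤ M := by
  have hr' : 1 - r ≠ 0 := (tsub_pos_of_lt hr).ne'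
  have hfix : r * (b * (1 - r)⁻¹) + b = b * (1 - r)⁻¹ := by
    calc r * (b * (1 - r)⁻¹) + b = r * (b * (1 - r)⁻¹) + (1 - r) * (b * (1 - r)⁻¹) := by
          rw [mul_left_comm (1 - r), ENNReal.mul_inv_cancel hr'
            (ENNReal.sub_ne_top ENNReal.one_ne_top), mul_one]
      _ = b * (1 - r)⁻¹ := by rw [← add_mul, add_tsub_cancel_of_le hr.le, one_mul]
  have hM : b * (1 - r)⁻¹ ≠ ⊤ := ENNReal.mul_ne_top hb (ENNReal.inv_ne_top.2 hr')
  refine ⟨(b * (1 - r)⁻¹).toNNReal, fun k => ?_⟩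
  rw [ENNReal.coe_toNNReal hM]
  induction k with
  | zero => exact h0.trans (hfix ▸ le_add_self)
  | succ k ih => exact (hu k).trans (hfix ▸ add_le_add_left (mul_le_mul_right ih r) b)

section ContractionMoments

variable {μ : Measure BranchVec} {α : ℝ}

lemma exists_lintegral_enorm_lawR_le [IsProbabilityMeasure μ] (hQ : ∫⁻ v, ‖BranchVec.Q v‖ₑ ∂μ ≠ ⊤)
    (h1 : lrho μ 1 < 1) : ∃ M : NNReal, ∀ k, ∫⁻ x, ‖x‖ₑ ∂(lawR μ k) ≤ M :=
  exists_forall_le_of_affine_recursion h1 hQ (lintegral_lawR_zero measurable_enorm).le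
    fun _ => lintegral_enorm_smoothing_le

lemma lintegral_enorm_Q_add_mul_rpow_ne_top (hα : 1 ≤ α)
    (hQ : ∫⁻ v, ‖BranchVec.Q v‖ₑ ^ α ∂μ ≠ ⊤)
    (hC : ∫⁻ v, (∑ i ∈ Finset.range (BranchVec.N v), ‖BranchVec.C v i‖ₑ) ^ α ∂μ ≠ ⊤)
    (M : NNReal) :
    ∫⁻ v, (‖BranchVec.Q v‖ₑ +
      (∑ i ∈ Finset.range (BranchVec.N v), ‖BranchVec.C v i‖ₑ) * M) ^ α ∂μ ≠ ⊤ := by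
  have hα0 : 0 ≤ α := zero_le_one.trans hα
  have hm : Measurable fun v => ∑ i ∈ Finset.range (BranchVec.N v), ‖BranchVec.C v i‖ₑ :=
    measurable_sum_range measurable_N fun i => by fun_prop
  refine ne_top_of_le_ne_top ?_ (lintegral_mono fun v =>
    ENNReal.rpow_add_le_mul_rpow_add_rpow _ _ hα)
  simp only [ENNReal.mul_rpow_of_nonneg _ _ hα0]
  rw [lintegral_const_mul _ (by fun_prop), lintegral_add_left (by fun_prop),
    lintegral_mul_const _ (by fun_prop)]
  have h2 : (2 : ℝ≥0∞) ^ (α - 1) ≠ ⊤ :=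
    ENNReal.rpow_ne_top_of_nonneg (sub_nonneg.2 hα) ENNReal.ofNat_ne_top
  have hM : (M : ℝ≥0∞) ^ α ≠ ⊤ := ENNReal.rpow_ne_top_of_nonneg hα0 ENNReal.coe_ne_top
  exact ENNReal.mul_ne_top h2 (ENNReal.add_ne_top.2 ⟨hQ, ENNReal.mul_ne_top hC hM⟩)

lemma exists_lintegral_enorm_rpow_lawR_le [IsProbabilityMeasure μ] (hα1 : 1 < α) (hα2 : α ≤ 2)
    (hQ : ∫⁻ v, ‖BranchVec.Q v‖ₑ ^ α ∂μ ≠ ⊤)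
    (hC : ∫⁻ v, (∑ i ∈ Finset.range (BranchVec.N v), ‖BranchVec.C v i‖ₑ) ^ α ∂μ ≠ ⊤)
    (h1 : lrho μ 1 < 1) (hα : lrho μ α < 1) :
    ∃ M : NNReal, ∀ k, ∫⁻ x, ‖x‖ₑ ^ α ∂(lawR μ k) ≤ M := by
  have hα0 : 0 ≤ α := zero_le_one.trans hα1.le
  have hQ1 : ∫⁻ v, ‖BranchVec.Q v‖ₑ ∂μ ≠ ⊤ := by
    have h := lintegral_rpow_le_one_add (P := μ) (fun v => ‖BranchVec.Q v‖ₑ) zero_le_one hα1.le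
    simp only [ENNReal.rpow_one] at h
    exact ne_top_of_le_ne_top (ENNReal.add_ne_top.2 ⟨ENNReal.one_ne_top, hQ⟩) h
  obtain ⟨M, hM⟩ := exists_lintegral_enorm_lawR_le hQ1 h1
  refine exists_forall_le_of_affine_recursion hα
    (lintegral_enorm_Q_add_mul_rpow_ne_top hα1.le hQ hC M) ?_ fun k => ?_
  · rw [lintegral_lawR_zero (by fun_prop)]
    exact lintegral_mono fun v => ENNReal.rpow_le_rpow le_self_add hα0
  · refine (lintegral_enorm_rpow_smoothing_le hα1 hα2).trans (add_le_add_right ?_ _)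
    exact lintegral_mono fun v => ENNReal.rpow_le_rpow
      (add_le_add_right (mul_le_mul_right (hM k) _) _) hα0

end ContractionMoments

section CenteredMoments

variable {F : Measure ℝ} [IsProbabilityMeasure F]

lemma integral_step (hF : Integrable id F) (v : BranchVec) :
    ∫ w, step v w ∂(Measure.infinitePi fun _ : ℕ => F) =
      (∑ r ∈ Finset.range (BranchVec.N v), BranchVec.C v r) * ∫ x, x ∂F + BranchVec.Q v := by
  have heval (r : ℕ) := measurePreserving_eval_infinitePi (fun _ : ℕ => F) r
  have hint (r : ℕ) : Integrable (fun w : ℕ → ℝ => BranchVec.C v r * w r)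
      (Measure.infinitePi fun _ : ℕ => F) :=
    ((heval r).integrable_comp_of_integrable hF).const_mul _
  have hmean (r : ℕ) : ∫ w, w r ∂(Measure.infinitePi fun _ : ℕ => F) = ∫ x, x ∂F := by
    conv_rhs => rw [← (heval r).map_eq]
    exact (integral_map (heval r).measurable.aemeasurable
      aestronglyMeasurable_id).symm
  simp only [step]
  rw [integral_add (integrable_finsetSum _ fun r _ => hint r) (integrable_const _),
    integral_finsetSum _ fun r _ => hint r]
  simp [integral_const_mul, hmean, Finset.sum_mul]

lemma memLp_mul_eval (hF : MemLp id 2 F) (c : ℝ) (r : ℕ) :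
    MemLp (fun w : ℕ → ℝ => c * w r) 2 (Measure.infinitePi fun _ : ℕ => F) :=
  (hF.comp_measurePreserving (measurePreserving_eval_infinitePi _ r)).const_mul c

lemma memLp_sum_mul_eval (hF : MemLp id 2 F) (s : Finset ℕ) (c : ℕ → ℝ) :
    MemLp (fun w : ℕ → ℝ => ∑ r ∈ s, c r * w r) 2 (Measure.infinitePi fun _ : ℕ => F) :=
  memLp_finsetSum _ fun r _ => memLp_mul_eval hF (c r) r

lemma memLp_step (hF : MemLp id 2 F) (v : BranchVec) :
    MemLp (step v) 2 (Measure.infinitePi fun _ : ℕ => F) :=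
  (memLp_sum_mul_eval hF _ _).add (memLp_const _)

lemma variance_step (hF : MemLp id 2 F) (v : BranchVec) :
    Var[step v; Measure.infinitePi fun _ : ℕ => F] =
      (∑ r ∈ Finset.range (BranchVec.N v), BranchVec.C v r ^ 2) * Var[id; F] := by
  have heval (r : ℕ) := measurePreserving_eval_infinitePi (fun _ : ℕ => F) r
  have hind : iIndepFun (fun r (w : ℕ → ℝ) => BranchVec.C v r * w r)
      (Measure.infinitePi fun _ : ℕ => F) :=
    iIndepFun_infinitePi (X := fun r x => BranchVec.C v r * x) fun r => by fun_prop
  have hvar (r : ℕ) : Var[fun w : ℕ → ℝ => BranchVec.C v r * w r;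
      Measure.infinitePi fun _ : ℕ => F] = BranchVec.C v r ^ 2 * Var[id; F] := by
    rw [variance_const_mul, ← (heval r).variance_fun_comp aemeasurable_id]
    rfl
  change Var[fun w : ℕ → ℝ => (∑ r ∈ Finset.range (BranchVec.N v), BranchVec.C v r * w r) +
    BranchVec.Q v; Measure.infinitePi fun _ : ℕ => F] = _
  rw [variance_add_const (memLp_sum_mul_eval hF _ _).aestronglyMeasurable, ← Finset.sum_fn,
    IndepFun.variance_sum (fun r _ => memLp_mul_eval hF _ r) fun i _ j _ hij => hind.indepFun hij,
    Finset.sum_mul]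
  exact Finset.sum_congr rfl fun r _ => hvar r

lemma enorm_rpow_two (x : ℝ) : ‖x‖ₑ ^ (2 : ℝ) = ENNReal.ofReal (x ^ 2) := by
  rw [ENNReal.rpow_two, Real.enorm_eq_ofReal_abs, ← ENNReal.ofReal_pow (abs_nonneg _), sq_abs]

lemma lintegral_enorm_sq_eq {Ω : Type*} [MeasurableSpace Ω] {P : Measure Ω}
    [IsProbabilityMeasure P] {X : Ω → ℝ} (hX : MemLp X 2 P) :
    ∫⁻ ω, ‖X ω‖ₑ ^ (2 : ℝ) ∂P = ENNReal.ofReal (Var[X; P] + P[X] ^ 2) := by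
  simp only [enorm_rpow_two]
  rw [variance_eq_sub hX, sub_add_cancel]
  exact (ofReal_integral_eq_lintegral_ofReal hX.integrable_sq
    (ae_of_all _ fun ω => sq_nonneg _)).symm

lemma memLp_two_of_lintegral_ne_top {G : Measure ℝ} (h : ∫⁻ x, ‖x‖ₑ ^ (2 : ℝ) ∂G ≠ ⊤) :
    MemLp id 2 G := by
  refine ⟨aestronglyMeasurable_id, ?_⟩
  rw [eLpNorm_lt_top_iff_lintegral_rpow_enorm_lt_top two_ne_zero ENNReal.ofNat_ne_top]
  simpa using h.lt_top

lemma lintegral_enorm_step_sq (hF : MemLp id 2 F) (h0 : ∫ x, x ∂F = 0) (v : BranchVec) :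
    ∫⁻ w, ‖step v w‖ₑ ^ (2 : ℝ) ∂(Measure.infinitePi fun _ : ℕ => F) =
      (∑ i ∈ Finset.range (BranchVec.N v), ‖BranchVec.C v i‖ₑ ^ (2 : ℝ)) *
        ∫⁻ x, ‖x‖ₑ ^ (2 : ℝ) ∂F + ‖BranchVec.Q v‖ₑ ^ (2 : ℝ) := by
  have hC : 0 ≤ ∑ r ∈ Finset.range (BranchVec.N v), BranchVec.C v r ^ 2 :=
    Finset.sum_nonneg fun _ _ => sq_nonneg _
  have hid := lintegral_enorm_sq_eq hF
  simp only [id_eq, h0, zero_pow two_ne_zero, add_zero] at hid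
  rw [lintegral_enorm_sq_eq (memLp_step hF v), integral_step (hF.integrable one_le_two),
    variance_step hF, h0, hid, mul_zero, zero_add]
  simp only [enorm_rpow_two]
  rw [← ENNReal.ofReal_sum_of_nonneg fun _ _ => sq_nonneg _, ← ENNReal.ofReal_mul hC,
    ← ENNReal.ofReal_add (mul_nonneg hC (variance_nonneg _ _)) (sq_nonneg _)]

variable {μ : Measure BranchVec}

lemma lintegral_enorm_sq_smoothing (hF : MemLp id 2 F) (h0 : ∫ x, x ∂F = 0) :
    ∫⁻ x, ‖x‖ₑ ^ (2 : ℝ) ∂(smoothing μ F) =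
      lrho μ 2 * ∫⁻ x, ‖x‖ₑ ^ (2 : ℝ) ∂F + ∫⁻ v, ‖BranchVec.Q v‖ₑ ^ (2 : ℝ) ∂μ := by
  rw [lintegral_smoothing (by fun_prop), lrho, ← lintegral_mul_const _
    (measurable_sum_range measurable_N fun i => by fun_prop), ← lintegral_add_right _ (by fun_prop)]
  exact lintegral_congr fun v => lintegral_enorm_step_sq hF h0 v

lemma integral_smoothing_of_centered [SFinite μ] (hF : Integrable id F) (h0 : ∫ x, x ∂F = 0)
    (hs : Integrable id (smoothing μ F)) :
    ∫ x, x ∂(smoothing μ F) = ∫ v, BranchVec.Q v ∂μ := by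
  have hi : Integrable (fun p : BranchVec × (ℕ → ℝ) => step p.1 p.2)
      (μ.prod (Measure.infinitePi fun _ : ℕ => F)) :=
    (integrable_map_measure (by fun_prop) measurable_step.aemeasurable).1 hs
  rw [smoothing, integral_map measurable_step.aemeasurable (by fun_prop), integral_prod _ hi]
  simp only [integral_step hF, h0, mul_zero, zero_add]

variable [IsProbabilityMeasure μ]

lemma memLp_and_centered_lawR (hQ : ∫⁻ v, ‖BranchVec.Q v‖ₑ ^ (2 : ℝ) ∂μ ≠ ⊤)
    (hQ0 : ∫ v, BranchVec.Q v ∂μ = 0) (h2 : lrho μ 2 ≠ ⊤) (k : ℕ) :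
    MemLp id 2 (lawR μ k) ∧ ∫ x, x ∂(lawR μ k) = 0 := by
  induction k with
  | zero =>
    refine ⟨memLp_two_of_lintegral_ne_top ?_, ?_⟩
    · rwa [lintegral_lawR_zero (by fun_prop)]
    · rw [lawR, integral_map measurable_Q.aemeasurable (by fun_prop), hQ0]
  | succ k ih =>
    obtain ⟨hL, h0⟩ := ih
    have hid := lintegral_enorm_sq_eq hL
    simp only [id_eq] at hid
    have hs : MemLp id 2 (smoothing μ (lawR μ k)) := by
      refine memLp_two_of_lintegral_ne_top ?_
      rw [lintegral_enorm_sq_smoothing hL h0, hid]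
      exact ENNReal.add_ne_top.2 ⟨ENNReal.mul_ne_top h2 ENNReal.ofReal_ne_top, hQ⟩
    exact ⟨hs, (integral_smoothing_of_centered (hL.integrable one_le_two) h0
      (hs.integrable one_le_two)).trans hQ0⟩

lemma exists_lintegral_enorm_sq_lawR_le (hQ : ∫⁻ v, ‖BranchVec.Q v‖ₑ ^ (2 : ℝ) ∂μ ≠ ⊤)
    (hQ0 : ∫ v, BranchVec.Q v ∂μ = 0) (h2 : lrho μ 2 < 1) :
    ∃ M : NNReal, ∀ k, ∫⁻ x, ‖x‖ₑ ^ (2 : ℝ) ∂(lawR μ k) ≤ M :=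
  exists_forall_le_of_affine_recursion h2 hQ (lintegral_lawR_zero (by fun_prop)).le fun k =>
    have h := memLp_and_centered_lawR hQ hQ0 h2.ne_top k
    (lintegral_enorm_sq_smoothing h.1 h.2).le

end CenteredMoments

section UniformMoments

variable {μ : Measure BranchVec} [IsProbabilityMeasure μ] {α β : ℝ}

lemma lintegral_enorm_rpow_ne_top {X : BranchVec → ℝ} (hX0 : 0 ≤ X)
    (h : Integrable (fun v => X v ^ β) μ) (hα : 0 ≤ α) (hαβ : α ≤ β) :
    ∫⁻ v, ‖X v‖ₑ ^ α ∂μ ≠ ⊤ := by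
  have hβ : ∫⁻ v, ‖X v‖ₑ ^ β ∂μ ≠ ⊤ := by
    simp only [← Real.enorm_rpow_of_nonneg (hX0 _) (hα.trans hαβ)]
    exact h.hasFiniteIntegral.ne
  exact ne_top_of_le_ne_top (ENNReal.add_ne_top.2 ⟨ENNReal.one_ne_top, hβ⟩)
    (lintegral_rpow_le_one_add _ hα hαβ)

theorem exists_uniform_moment_bound (hα1 : 1 < α) (hα2 : α < 2) (hαβ : α ≤ β)
    (hQ : Integrable (fun v => |BranchVec.Q v| ^ β) μ)
    (hC : Integrable
      (fun v => (∑ i ∈ Finset.range (BranchVec.N v), |BranchVec.C v i|) ^ β) μ)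
    (h : max (rho μ 1) (rho μ β) < 1 ∨
      (β = 2 ∧ rho μ β < 1 ∧ ∫ v, BranchVec.Q v ∂μ = 0)) :
    ∃ M : NNReal, ∀ k, ∫⁻ x, ‖x‖ₑ ^ α ∂(lawR μ k) ≤ M := by
  have hα0 : 0 ≤ α := by linarith
  have hlrho {γ : ℝ} (hγ : γ ∈ Icc 1 β) (h : rho μ γ < 1) : lrho μ γ < 1 := by
    rw [lrho_eq_ofReal_rho (zero_le_one.trans hγ.1) (integrable_sum_abs_C_rpow hC hγ)]
    exact ENNReal.ofReal_lt_one.2 h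
  have hQγ {γ : ℝ} (hγ : 0 ≤ γ) (hγβ : γ ≤ β) : ∫⁻ v, ‖BranchVec.Q v‖ₑ ^ γ ∂μ ≠ ⊤ := by
    simpa only [Real.enorm_abs] using lintegral_enorm_rpow_ne_top (X := fun v => |BranchVec.Q v|)
      (fun _ => abs_nonneg _) hQ hγ hγβ
  rcases h with hmax | ⟨rfl, hρ, hQ0⟩
  · have hCα := lintegral_enorm_rpow_ne_top
      (X := fun v => ∑ i ∈ Finset.range (BranchVec.N v), |BranchVec.C v i|)
      (fun _ => Finset.sum_nonneg fun _ _ => abs_nonneg _) hC hα0 hαβ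
    simp only [enorm_sum_abs_C] at hCα
    exact exists_lintegral_enorm_rpow_lawR_le hα1 hα2.le (hQγ hα0 hαβ) hCα
      (hlrho ⟨le_rfl, hα1.le.trans hαβ⟩ ((le_max_left _ _).trans_lt hmax))
      (hlrho ⟨hα1.le, hαβ⟩ ((rho_le_max hC ⟨hα1.le, hαβ⟩).trans_lt hmax))
  · obtain ⟨M, hM⟩ := exists_lintegral_enorm_sq_lawR_le (hQγ zero_le_two le_rfl) hQ0
      (hlrho ⟨one_le_two, le_rfl⟩ hρ)
    refine ⟨1 + M, fun k => ?_⟩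
    push_cast
    exact (lintegral_rpow_le_one_add _ hα0 hαβ).trans (add_le_add_right (hM k) 1)

end UniformMoments

section Pool

variable {m : ℕ}

/-- The next pool when member `i` receives the branching vector `(w i).1` and draws the members of
the current pool `x` at the positions `(w i).2 r`. -/
def nextPool (x : Fin m → ℝ) (w : Fin m → BranchVec × (ℕ → Fin m)) : Fin m → ℝ :=
  fun i => step (w i).1 fun r => x ((w i).2 r)

lemma measurable_nextPool :
    Measurable fun p : (Fin m → ℝ) × (Fin m → BranchVec × (ℕ → Fin m)) => nextPool p.1 p.2 := by
  have heval : Measurable fun p : (Fin m → ℝ) × Fin m => p.1 p.2 :=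
    measurable_from_prod_countable_left fun i => measurable_pi_apply i
  refine measurable_pi_lambda _ fun i => measurable_step.comp (Measurable.prodMk (by fun_prop) ?_)
  exact measurable_pi_lambda _ fun r =>
    heval.comp (measurable_fst.prodMk (by fun_prop))

/-- The law of a branching vector together with the positions drawn for its summands, which are
independent of it and independently uniform. -/
abbrev drawLaw (μ : Measure BranchVec) (m : ℕ) : Measure (BranchVec × (ℕ → Fin m)) :=
  μ.prod (Measure.infinitePi fun _ => uniformOn univ)

lemma map_nextPool {μ : Measure BranchVec} [IsProbabilityMeasure μ] [NeZero m] (x : Fin m → ℝ) :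
    (Measure.pi fun _ : Fin m => drawLaw μ m).map (nextPool x) =
      Measure.pi fun _ => smoothing μ (empirical x) := by
  have hx : Measurable x := measurable_of_finite x
  rw [← map_uniformOn_univ, ← map_step_comp _ hx, pi_map_const (measurable_step_comp hx)]
  rfl

variable {Ω : Type*}

/-- The branching vector and the drawn positions that the algorithm uses for member `p.2` of the
pool at level `p.1 + 1`. -/
def drawInput (V : ℕ → Fin m → Ω → BranchVec) (I : ℕ → Fin m → ℕ → Ω → Fin m)
    (p : ℕ × Fin m) (ω : Ω) : BranchVec × (ℕ → Fin m) :=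
  (V p.1 p.2 ω, fun r => I p.1 p.2 r ω)

/-- All the input that the algorithm uses to pass from level `j` to level `j + 1`. -/
def levelInput (V : ℕ → Fin m → Ω → BranchVec) (I : ℕ → Fin m → ℕ → Ω → Fin m)
    (j : ℕ) (ω : Ω) (i : Fin m) : BranchVec × (ℕ → Fin m) :=
  drawInput V I (j, i) ω

lemma pool_zero (Q₀ : Fin m → Ω → ℝ) (V : ℕ → Fin m → Ω → BranchVec)
    (I : ℕ → Fin m → ℕ → Ω → Fin m) : pool Q₀ V I 0 = fun ω i => Q₀ i ω :=
  rfl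

namespace IsAlgorithmInput

variable [MeasurableSpace Ω] {μ : Measure BranchVec} {P : Measure Ω} {Q₀ : Fin m → Ω → ℝ}
  {V : ℕ → Fin m → Ω → BranchVec} {I : ℕ → Fin m → ℕ → Ω → Fin m}

lemma measurable_drawInput (h : IsAlgorithmInput μ P Q₀ V I) (p : ℕ × Fin m) :
    Measurable (drawInput V I p) :=
  (h.measurable_V p.1 p.2).prodMk (measurable_pi_lambda _ (h.measurable_I p.1 p.2))

lemma measurable_levelInput (h : IsAlgorithmInput μ P Q₀ V I) (j : ℕ) :
    Measurable (levelInput V I j) :=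
  measurable_pi_lambda _ fun i => h.measurable_drawInput (j, i)

lemma measurable_pool (h : IsAlgorithmInput μ P Q₀ V I) (j : ℕ) :
    Measurable (pool Q₀ V I j) := by
  induction j with
  | zero => exact measurable_pi_lambda _ h.measurable_Q₀
  | succ j ih => exact measurable_nextPool.comp (ih.prodMk (h.measurable_levelInput j))

lemma indepFun_V_positions (h : IsAlgorithmInput μ P Q₀ V I) :
    IndepFun (fun ω (p : ℕ × Fin m) => V p.1 p.2 ω)
      (fun ω (p : ℕ × Fin m) r => I p.1 p.2 r ω) P :=
  h.indep_V_I.comp measurable_id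
    (ψ := fun (z : ℕ × Fin m × ℕ → Fin m) (p : ℕ × Fin m) r => z (p.1, p.2, r)) (by fun_prop)

lemma map_drawInput [IsProbabilityMeasure μ] [NeZero m] (h : IsAlgorithmInput μ P Q₀ V I)
    (p : ℕ × Fin m) : P.map (drawInput V I p) = drawLaw μ m := by
  have := h.indep_V.isProbabilityMeasure
  have hind : IndepFun (V p.1 p.2) (fun ω r => I p.1 p.2 r ω) P :=
    h.indepFun_V_positions.comp (measurable_pi_apply p) (measurable_pi_apply p)
  have hpos : iIndepFun (I p.1 p.2) P := h.indep_I.precomp (g := fun r => (p.1, p.2, r))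
    fun r s hrs => by simpa using hrs
  have hjoint : P.map (drawInput V I p) =
      (P.map (V p.1 p.2)).prod (P.map fun ω r => I p.1 p.2 r ω) :=
    (indepFun_iff_map_prod_eq_prod_map_map (h.measurable_V p.1 p.2).aemeasurable
      (measurable_pi_lambda _ (h.measurable_I p.1 p.2)).aemeasurable).1 hind
  rw [hjoint, hpos.map_fun_eq_infinitePi_map (h.measurable_I p.1 p.2), h.law_V]
  simp only [h.law_I]

lemma iIndepFun_drawInput (h : IsAlgorithmInput μ P Q₀ V I) :
    iIndepFun (drawInput V I) P := by
  have hpos : iIndepFun (fun (p : (ℕ × Fin m) × ℕ) => I p.1.1 p.1.2 p.2) P :=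
    h.indep_I.precomp (Equiv.prodAssoc ℕ (Fin m) ℕ).injective
  exact iIndepFun_prodMk (fun p => h.measurable_V p.1 p.2)
    (fun p => measurable_pi_lambda _ (h.measurable_I p.1 p.2)) h.indep_V
    (iIndepFun_curry hpos fun _ => h.measurable_I _ _ _) h.indepFun_V_positions

lemma iIndepFun_levelInput (h : IsAlgorithmInput μ P Q₀ V I) : iIndepFun (levelInput V I) P :=
  iIndepFun_curry h.iIndepFun_drawInput h.measurable_drawInput

lemma map_levelInput [IsProbabilityMeasure μ] [NeZero m] (h : IsAlgorithmInput μ P Q₀ V I)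
    (j : ℕ) : P.map (levelInput V I j) = Measure.pi fun _ => drawLaw μ m := by
  have := h.indep_V.isProbabilityMeasure
  have hrow : iIndepFun (fun i => drawInput V I (j, i)) P :=
    h.iIndepFun_drawInput.precomp (Prod.mk_right_injective j)
  have hlaw : P.map (levelInput V I j) = Measure.pi fun i => P.map (drawInput V I (j, i)) :=
    (iIndepFun_iff_map_fun_eq_pi_map fun i =>
      (h.measurable_drawInput (j, i)).aemeasurable).1 hrow
  simpa only [h.map_drawInput] using hlaw

lemma indepFun_levelInput_future (h : IsAlgorithmInput μ P Q₀ V I) (j : ℕ) :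
    IndepFun (levelInput V I j) (fun ω n => levelInput V I (j + 1 + n) ω) P := by
  have hdisj : Disjoint ({j} : Set ℕ) (Ici (j + 1)) := by simp
  exact (indepFun_restrict_of_disjoint h.iIndepFun_levelInput h.measurable_levelInput hdisj).comp
    (measurable_pi_apply ⟨j, rfl⟩)
    (ψ := fun z n => z ⟨j + 1 + n, Nat.le_add_right _ _⟩) (by fun_prop)

lemma indepFun_pool_future (h : IsAlgorithmInput μ P Q₀ V I) (j : ℕ) :
    IndepFun (pool Q₀ V I j) (fun ω n => levelInput V I (j + n) ω) P := by
  have := h.indep_V.isProbabilityMeasure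
  induction j with
  | zero =>
    exact h.indep_Q₀_V_I.comp measurable_id
      (ψ := fun z n i => (z.1 (0 + n, i), fun r => z.2 (0 + n, i, r))) (by fun_prop)
  | succ j ih =>
    have hsplit : IndepFun (pool Q₀ V I j) (fun ω =>
        (levelInput V I j ω, fun n => levelInput V I (j + 1 + n) ω)) P := by
      simp only [add_right_comm j 1]
      exact ih.comp measurable_id (ψ := fun z => (z 0, fun n => z (n + 1))) (by fun_prop)
    exact (indepFun_prodMk_left (h.measurable_pool j) (h.measurable_levelInput j)
      (measurable_pi_lambda _ fun n => h.measurable_levelInput _) hsplit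
      (h.indepFun_levelInput_future j)).comp measurable_nextPool measurable_id

lemma lintegral_pool_zero [IsProbabilityMeasure μ] (h : IsAlgorithmInput μ P Q₀ V I)
    {f : (Fin m → ℝ) → ℝ≥0∞} (hf : Measurable f) :
    ∫⁻ ω, f (pool Q₀ V I 0 ω) ∂P = ∫⁻ y, f y ∂(Measure.pi fun _ => lawR μ 0) := by
  have := h.indep_V.isProbabilityMeasure
  have hlaw := (iIndepFun_iff_map_fun_eq_pi_map fun i =>
    (h.measurable_Q₀ i).aemeasurable).1 h.indep_Q₀
  simp only [h.law_Q₀] at hlaw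
  rw [← lintegral_map hf (h.measurable_pool 0), pool_zero, hlaw]
  rfl

lemma lintegral_pool_succ [IsProbabilityMeasure μ] [NeZero m]
    (h : IsAlgorithmInput μ P Q₀ V I) (j : ℕ) {f : (Fin m → ℝ) → ℝ≥0∞} (hf : Measurable f) :
    ∫⁻ ω, f (pool Q₀ V I (j + 1) ω) ∂P =
      ∫⁻ ω, ∫⁻ y, f y ∂(Measure.pi fun _ => smoothing μ (empirical (pool Q₀ V I j ω))) ∂P := by
  have := h.indep_V.isProbabilityMeasure
  have hpool := h.measurable_pool j
  have hinput := h.measurable_levelInput j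
  have hind : IndepFun (pool Q₀ V I j) (levelInput V I j) P :=
    (h.indepFun_pool_future j).comp measurable_id (measurable_pi_apply 0)
  have hjoint := (indepFun_iff_map_prod_eq_prod_map_map hpool.aemeasurable
    hinput.aemeasurable).1 hind
  rw [h.map_levelInput] at hjoint
  have hfn : Measurable fun p : (Fin m → ℝ) × (Fin m → BranchVec × (ℕ → Fin m)) =>
      f (nextPool p.1 p.2) := hf.comp measurable_nextPool
  calc ∫⁻ ω, f (pool Q₀ V I (j + 1) ω) ∂P
      = ∫⁻ p, f (nextPool p.1 p.2) ∂(P.map fun ω => (pool Q₀ V I j ω, levelInput V I j ω)) :=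
        (lintegral_map hfn (hpool.prodMk hinput)).symm
    _ = ∫⁻ x, ∫⁻ w, f (nextPool x w) ∂(Measure.pi fun _ => drawLaw μ m) ∂P.map
          (pool Q₀ V I j) := by rw [hjoint, lintegral_prod _ hfn.aemeasurable]
    _ = ∫⁻ ω, ∫⁻ w, f (nextPool (pool Q₀ V I j ω) w) ∂(Measure.pi fun _ => drawLaw μ m) ∂P :=
        lintegral_map hfn.lintegral_prod_right' hpool
    _ = _ := by
        refine lintegral_congr fun ω => ?_
        rw [← map_nextPool]
        exact (lintegral_map hf (measurable_nextPool.comp measurable_prodMk_left)).symm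

lemma lintegral_cdfDist_pool_le [IsProbabilityMeasure μ] [NeZero m]
    (h : IsAlgorithmInput μ P Q₀ V I) {D : ℝ≥0∞}
    (hD : ∀ k, ∫⁻ y, cdfDist (empirical y) (lawR μ k)
      ∂(Measure.pi fun _ : Fin m => lawR μ k) ≤ D) (k : ℕ) :
    ∫⁻ ω, cdfDist (empirical (pool Q₀ V I k ω)) (lawR μ k) ∂P ≤
      (∑ i ∈ Finset.range (k + 1), lrho μ 1 ^ i) * D := by
  induction k with
  | zero =>
    rw [h.lintegral_pool_zero (measurable_cdfDist_empirical _)]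
    simpa using hD 0
  | succ k ih =>
    calc ∫⁻ ω, cdfDist (empirical (pool Q₀ V I (k + 1) ω)) (lawR μ (k + 1)) ∂P
        ≤ ∫⁻ ω, (lrho μ 1 * cdfDist (empirical (pool Q₀ V I k ω)) (lawR μ k) + D) ∂P := by
          rw [h.lintegral_pool_succ k (measurable_cdfDist_empirical _)]
          exact lintegral_mono fun ω => (lintegral_cdfDist_smoothing_le _ _).trans
            (add_le_add_right (hD (k + 1)) _)
      _ = lrho μ 1 * ∫⁻ ω, cdfDist (empirical (pool Q₀ V I k ω)) (lawR μ k) ∂P + D := by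
          have := h.indep_V.isProbabilityMeasure
          have hm := (measurable_cdfDist_empirical (lawR μ k)).comp (h.measurable_pool k)
          rw [lintegral_add_right _ measurable_const, lintegral_const, measure_univ, mul_one]
          exact congrArg (· + D) (lintegral_const_mul _ hm)
      _ ≤ lrho μ 1 * ((∑ i ∈ Finset.range (k + 1), lrho μ 1 ^ i) * D) + D := by gcongr
      _ = (∑ i ∈ Finset.range (k + 1 + 1), lrho μ 1 ^ i) * D := by
          rw [Finset.sum_range_succ' _ (k + 1), pow_zero, add_mul, one_mul, ← mul_assoc,
            Finset.mul_sum]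
          simp only [pow_succ']

end IsAlgorithmInput

end Pool

end IterBootstrap

end

open IterBootstrap in
theorem theoremT_general (μ : Measure BranchVec) [IsProbabilityMeasure μ]
    {α β : ℝ} (hα1 : 1 < α) (hα2 : α < 2) (hαβ : α ≤ β)
    (hQ : Integrable (fun v => |BranchVec.Q v| ^ β) μ)
    (hC : Integrable (fun v => (∑ i ∈ Finset.range (BranchVec.N v), |BranchVec.C v i|) ^ β) μ)
    (h : max (rho μ 1) (rho μ β) < 1 ∨ (β = 2 ∧ rho μ β < 1 ∧ ∫ v, BranchVec.Q v ∂μ = 0)) :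
    ∃ K : ℝ, 0 ≤ K ∧
      ∀ (Ω' : Type*) [MeasurableSpace Ω'] (P' : Measure Ω') (V' : List ℕ → Ω' → BranchVec)
        (_ : IsBranchingFamily μ P' V') (m : ℕ) (_ : 1 ≤ m)
        (Ω : Type*) [MeasurableSpace Ω] (P : Measure Ω)
        (Q₀ : Fin m → Ω → ℝ) (V : ℕ → Fin m → Ω → BranchVec) (I : ℕ → Fin m → ℕ → Ω → Fin m)
        (_ : IsAlgorithmInput μ P Q₀ V I) (k : ℕ),
        ∫⁻ ω, d1 (empirical (pool Q₀ V I k ω)) (P'.map (R V' k)) ∂P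
          ≤ ENNReal.ofReal (K * (m : ℝ) ^ (-1 + 1 / α) *
              ∑ i ∈ Finset.range (k + 1), rho μ 1 ^ i) := by
  obtain ⟨M, hM⟩ := exists_uniform_moment_bound hα1 hα2 hαβ hQ hC h
  refine ⟨rateConst α M, rateConst_nonneg hα1 hα2 M.coe_nonneg, ?_⟩
  intro Ω' _ P' V' hV' m hm Ω _ P Q₀ V I hI k
  have : NeZero m := ⟨by lia⟩
  have hlrho : lrho μ 1 = ENNReal.ofReal (rho μ 1) := lrho_eq_ofReal_rho zero_le_one
    (integrable_sum_abs_C_rpow hC ⟨le_rfl, hα1.le.trans hαβ⟩)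
  rw [hV'.map_R k]
  calc ∫⁻ ω, d1 (empirical (pool Q₀ V I k ω)) (lawR μ k) ∂P
      ≤ ∫⁻ ω, cdfDist (empirical (pool Q₀ V I k ω)) (lawR μ k) ∂P :=
        lintegral_mono fun ω => d1_le_cdfDist _ _
    _ ≤ (∑ i ∈ Finset.range (k + 1), lrho μ 1 ^ i) *
          ENNReal.ofReal (rateConst α M * (m : ℝ) ^ (-1 + 1 / α)) :=
        hI.lintegral_cdfDist_pool_le
          (fun k => lintegral_cdfDist_empirical_le (lawR μ k) hα1 hα2 (hM k)) k
    _ = _ := by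
        simp only [hlrho, ← ENNReal.ofReal_pow rho_nonneg]
        rw [← ENNReal.ofReal_sum_of_nonneg fun i _ => pow_nonneg rho_nonneg i, mul_comm,
          ← ENNReal.ofReal_mul' (Finset.sum_nonneg fun i _ => pow_nonneg rho_nonneg i)]

theorem theoremT (μ : Measure IterBootstrap.BranchVec) [IsProbabilityMeasure μ]
    (β : ℝ) (hβ : 1 < β) (hμ : IterBootstrap.MomentConditions μ β)
    (α : ℝ) (hα1 : 1 < α) (hα2 : α < 2) (hαβ : α ≤ β) :
    ∃ K : ℝ, 0 ≤ K ∧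
      ∀ (Ω' : Type*) [MeasurableSpace Ω'] (P' : Measure Ω') [IsProbabilityMeasure P']
        (V' : List ℕ → Ω' → IterBootstrap.BranchVec)
        (_ : IterBootstrap.IsBranchingFamily μ P' V')
        (m : ℕ) (_ : 1 ≤ m)
        (Ω : Type*) [MeasurableSpace Ω] (P : Measure Ω) [IsProbabilityMeasure P]
        (Q₀ : Fin m → Ω → ℝ) (V : ℕ → Fin m → Ω → IterBootstrap.BranchVec)
        (I : ℕ → Fin m → ℕ → Ω → Fin m)
        (_ : IterBootstrap.IsAlgorithmInput μ P Q₀ V I) (k : ℕ),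
        ∫⁻ ω, IterBootstrap.d1 (IterBootstrap.empirical (IterBootstrap.pool Q₀ V I k ω))
            (P'.map (IterBootstrap.R V' k)) ∂P
          ≤ ENNReal.ofReal (K * (m : ℝ) ^ (-1 + 1 / α) *
              ∑ i ∈ Finset.range (k + 1), IterBootstrap.rho μ 1 ^ i) := by
  obtain ⟨K, hK, h⟩ := theoremT_general μ hα1 hα2 hαβ hμ.moment_Q hμ.moment_C
    (hμ.contraction.imp_right fun ⟨h2, _, hcontr, hmean⟩ => ⟨h2, hcontr, hmean⟩)
  exact ⟨K, hK, fun Ω' _ P' _ V' hV' m hm Ω _ P _ => h Ω' P' V' hV' m hm Ω P⟩
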